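/- All graphs are finite, simple and undirected. A graph $G=(V,E)$ is a *sum graph* if there is an injective map $\lambda:V\to\{1,2,3,\dots\}$ such that two distinct vertices $x,y$ are adjacent if and only if $\lambda(x)+\lambda(y)=\lambda(z)$ for some $z\in V$. The *sum number* $\sigma(G)$ of a graph $G$ without isolated vertices is the minimum number $k$ such that the disjoint union $G+N_k$ of $G$ with $k$ isolated vertices is a sum graph. Let $\delta(G)$ denote the minimum degree of $G$, let $C_n$ and $P_n$ denote the cycle and the path on $n$ vertices, and let $+$ denote the disjoint union of graphs. Theorem. Let $G$ be a graph without isolated vertices in which every vertex has degree at most two. If $G$ is isomorphic to $C_4$ or to $C_4+P_2$, then $\sigma(G)=\delta(G)+1$. Otherwise, $\sigma(G)=\delta(G)$. -/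

import Mathlib

universe u

/-- A sum labelling of a graph: an injective labelling of the vertices by positive integers such
that two distinct vertices are adjacent if and only if the sum of their labels is the label of
some vertex. -/
def SimpleGraph.IsSumLabelling {V : Type u} (G : SimpleGraph V) (l : V → ℕ) : Prop :=
  Function.Injective l ∧ (∀ v, 0 < l v) ∧
    ∀ x y, G.Adj x y ↔ x ≠ y ∧ ∃ z, l z = l x + l y

/-- A graph is a sum graph if it admits a sum labelling. -/
def SimpleGraph.IsSumGraph {V : Type u} (G : SimpleGraph V) : Prop :=
  ∃ l : V → ℕ, G.IsSumLabelling l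

/-- The disjoint union of `G` with `k` isolated vertices. -/
def SimpleGraph.addIsolates {V : Type u} (G : SimpleGraph V) (k : ℕ) : SimpleGraph (V ⊕ Fin k) :=
  G ⊕g (⊥ : SimpleGraph (Fin k))

/-- Every finite graph becomes a sum graph after adding some number of isolated vertices, so the
minimum defining the sum number is taken over a nonempty set. -/
theorem SimpleGraph.exists_isSumGraph_addIsolates {V : Type u} [Finite V] (G : SimpleGraph V) :
    ∃ k : ℕ, (G.addIsolates k).IsSumGraph := by
  classical
  obtain ⟨n, ⟨e⟩⟩ := Finite.exists_equiv_fin V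
  let f : V → ℕ := fun v => 5 * 2 ^ (e v : ℕ) + 1
  have hf : Function.Injective f := by
    intro a b h
    have h1 : 2 ^ (e a : ℕ) = 2 ^ (e b : ℕ) := by simp only [f] at h; omega
    exact e.injective (Fin.ext (Nat.pow_right_injective le_rfl h1))
  have hmod : ∀ v, f v % 5 = 1 := by intro v; simp only [f]; omega
  have hsidon : ∀ a b c d : V, a ≠ b → f a + f b = f c + f d →
      (a = c ∧ b = d) ∨ (a = d ∧ b = c) := by
    intro a b c d hab h
    have key : ∀ i j k l : ℕ, i < j → k ≤ l → 2 ^ i + 2 ^ j = 2 ^ k + 2 ^ l → i = k ∧ j = l := by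
      intro i j k l hij hkl h
      have hi : 0 < 2 ^ i := by positivity
      have hk : 0 < 2 ^ k := by positivity
      have hij' : 2 ^ i < 2 ^ j := Nat.pow_lt_pow_right (by norm_num) hij
      have hkl' : 2 ^ k ≤ 2 ^ l := Nat.pow_le_pow_right (by norm_num) hkl
      rcases lt_trichotomy j l with hjl | rfl | hjl
      · have : 2 ^ (j + 1) ≤ 2 ^ l := Nat.pow_le_pow_right (by norm_num) hjl
        rw [pow_succ] at this
        omega
      · exact ⟨Nat.pow_right_injective le_rfl (by simpa using h), rfl⟩
      · have : 2 ^ (l + 1) ≤ 2 ^ j := Nat.pow_le_pow_right (by norm_num) hjl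
        rw [pow_succ] at this
        omega
    have h1 : 2 ^ (e a : ℕ) + 2 ^ (e b : ℕ) = 2 ^ (e c : ℕ) + 2 ^ (e d : ℕ) := by
      simp only [f] at h; omega
    have hab' : (e a : ℕ) ≠ e b := fun h => hab (e.injective (Fin.ext h))
    have fin : ∀ x y : V, (e x : ℕ) = e y → x = y := fun x y h => e.injective (Fin.ext h)
    rcases lt_or_gt_of_ne hab' with h2 | h2 <;> rcases le_total (e c : ℕ) (e d) with h3 | h3
    · obtain ⟨p, q⟩ := key _ _ _ _ h2 h3 h1
      exact Or.inl ⟨fin _ _ p, fin _ _ q⟩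
    · obtain ⟨p, q⟩ := key _ _ _ _ h2 h3 (by omega)
      exact Or.inr ⟨fin _ _ p, fin _ _ q⟩
    · obtain ⟨p, q⟩ := key _ _ _ _ h2 h3 (by omega)
      exact Or.inr ⟨fin _ _ q, fin _ _ p⟩
    · obtain ⟨p, q⟩ := key _ _ _ _ h2 h3 (by omega)
      exact Or.inl ⟨fin _ _ q, fin _ _ p⟩
  let S : Set ℕ := {m | ∃ a b : V, G.Adj a b ∧ m = f a + f b}
  have hS : S.Finite := by
    refine (Set.finite_range (fun p : V × V => f p.1 + f p.2)).subset ?_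
    rintro m ⟨a, b, -, rfl⟩
    exact ⟨(a, b), rfl⟩
  have hSmod : ∀ m ∈ S, m % 5 = 2 := by
    rintro m ⟨a, b, -, rfl⟩
    have := hmod a
    have := hmod b
    omega
  have : Finite S := hS
  obtain ⟨k, ⟨g⟩⟩ := Finite.exists_equiv_fin S
  have hg : ∀ i, (g.symm i : ℕ) % 5 = 2 := fun i => hSmod _ (g.symm i).2
  refine ⟨k, Sum.elim f (fun i => (g.symm i : ℕ)), ?_, ?_, ?_⟩
  · rintro (a | i) (b | j) h
    · exact congrArg _ (hf h)
    · have := hmod a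
      have := hg j
      simp only [Sum.elim_inl, Sum.elim_inr] at h
      omega
    · have := hmod b
      have := hg i
      simp only [Sum.elim_inl, Sum.elim_inr] at h
      omega
    · exact congrArg _ (g.symm.injective (Subtype.ext h))
  · rintro (a | i)
    · have := hmod a
      simp only [Sum.elim_inl]
      omega
    · have := hg i
      simp only [Sum.elim_inr]
      omega
  · rintro (a | i) (b | j)
    · simp only [SimpleGraph.addIsolates, SimpleGraph.sum_adj_inl, Sum.elim_inl]
      constructor
      · intro h
        refine ⟨fun h' => h.ne (Sum.inl_injective h'), Sum.inr (g ⟨f a + f b, a, b, h, rfl⟩), ?_⟩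
        simp
      · rintro ⟨hab, c | m, h⟩
        · have := hmod a
          have := hmod b
          have := hmod c
          simp only [Sum.elim_inl] at h
          omega
        · obtain ⟨c, d, hcd, hm⟩ := (g.symm m).2
          simp only [Sum.elim_inr] at h
          rcases hsidon a b c d (fun h' => hab (congrArg _ h')) (by omega) with
            ⟨rfl, rfl⟩ | ⟨rfl, rfl⟩
          · exact hcd
          · exact hcd.symm
    all_goals
      simp only [SimpleGraph.addIsolates, SimpleGraph.sum_adj, Sum.elim_inl, Sum.elim_inr,
        SimpleGraph.bot_adj, false_iff]
      rintro ⟨-, c | m, h⟩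
    all_goals simp only [Sum.elim_inl, Sum.elim_inr] at h
    · have := hmod a
      have := hg j
      have := hmod c
      omega
    · have := hmod a
      have := hg j
      have := hg m
      omega
    · have := hg i
      have := hmod b
      have := hmod c
      omega
    · have := hg i
      have := hmod b
      have := hg m
      omega
    · have := hg i
      have := hg j
      have := hmod c
      omega
    · have := hg i
      have := hg j
      have := hg m
      omega

/-- The sum number of a finite graph: the least number of isolated vertices that have to be added
to it in order to obtain a sum graph. -/
noncomputable def SimpleGraph.sumNumber {V : Type u} (G : SimpleGraph V) : ℕ :=
  sInf {k : ℕ | (G.addIsolates k).IsSumGraph}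

/-! The lower bound comes from the vertex of `G` with the largest label: adding a neighbour's label
to its own exceeds every label of `G`, so distinct neighbours yield distinct isolates
(`exists_largest_vertex`).

For the upper bound, `G` is a disjoint union of paths and cycles (`exists_iso_union`), and the
components are stacked. Suppose the part already labelled has isolates `A > B` as its two largest
labels. The next component takes the Fibonacci-like sequence `A, B, A + B, A + 2B, …`, so the old
isolates become vertices. The only sums of two distinct terms that are again terms are those of the
recursion (`gibonacci.add_eq`), so consecutive terms form a path, whose one isolate is the next
term. A cycle needs a second isolate, the sum of its first and last labels. If there are paths, one
of them goes above all cycles other than four-cycles, which leaves a single isolate.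

This stacking fails for `C₄`, whose two isolates would differ by the label `B`. Four-cycles are
added by another device: if the labels contain a parallelogram `p, p + s, p + t, p + s + t` whose
sides `s, t` are not labels (`HasQuad`), all labels are multiplied by 10 and the vertices of `C₄`
receive labels congruent to 1 or 9 modulo 10 whose edge sums are the four multiplied corners
(`SumLabellingWith.add_cycleGraph_four`). No isolate is added, and the parallelogram survives for
the next four-cycle. `hasGoodLabelling` finds a parallelogram in all unions except the empty one,
`P₂`, `C₄` and `C₄ + P₂`.

In the two exceptional graphs all edge sums of `C₄` lie outside the cycle and at least three of them
are distinct (`exists_sums`), which forces one more isolate. -/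

/-! ### Sum labellings with a set of isolate labels, and stacking them. -/

/-- A labelling of the vertices of `G` which, together with isolated vertices carrying the labels
in `P`, is a sum labelling. -/
structure SumLabellingWith {V : Type*} (G : SimpleGraph V) (l : V → ℕ) (P : Finset ℕ) : Prop where
  inj : Function.Injective l
  pos : ∀ v, 0 < l v
  pos_out : ∀ p ∈ P, 0 < p
  disj : ∀ v, l v ∉ P
  adj_iff : ∀ x y, G.Adj x y ↔ x ≠ y ∧ ((∃ z, l z = l x + l y) ∨ l x + l y ∈ P)
  out : ∀ v, ∀ p ∈ P, (∀ z, l z ≠ l v + p) ∧ l v + p ∉ P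
  out_out : ∀ p ∈ P, ∀ q ∈ P, p ≠ q → (∀ z, l z ≠ p + q) ∧ p + q ∉ P

namespace SumLabellingWith

variable {V W : Type*} {G : SimpleGraph V} {H : SimpleGraph W} {l : V → ℕ} {P : Finset ℕ}

theorem comp_iso (h : SumLabellingWith G l P) (e : H ≃g G) : SumLabellingWith H (l ∘ e) P where
  inj := h.inj.comp e.injective
  pos v := h.pos _
  pos_out := h.pos_out
  disj v := h.disj _
  adj_iff x y := by
    rw [← e.map_adj_iff, h.adj_iff]
    simp only [Function.comp, ne_eq, e.injective.eq_iff]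
    rw [← e.surjective.exists (p := fun z => l z = l (e x) + l (e y))]
  out v p hp := ⟨fun z => (h.out (e v) p hp).1 (e z), (h.out (e v) p hp).2⟩
  out_out p hp q hq hpq := ⟨fun z => (h.out_out p hp q hq hpq).1 (e z), (h.out_out p hp q hq hpq).2⟩

theorem isSumGraph {V : Type*} {G : SimpleGraph V} {l : V → ℕ}
    (h : SumLabellingWith G l P) : (G.addIsolates P.card).IsSumGraph := by
  have hP : ∀ i, ((P.equivFin.symm i : P) : ℕ) ∈ P := fun i => (P.equivFin.symm i).2
  have hex : ∀ m, (∃ z, Sum.elim l (fun i => ((P.equivFin.symm i : P) : ℕ)) z = m) ↔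
      (∃ z, l z = m) ∨ m ∈ P := by
    intro m
    rw [Sum.exists]
    simp only [Sum.elim_inl, Sum.elim_inr]
    refine or_congr Iff.rfl ⟨?_, fun hm => ⟨P.equivFin ⟨m, hm⟩, by simp⟩⟩
    rintro ⟨i, rfl⟩
    exact hP i
  refine ⟨Sum.elim l (fun i => ((P.equivFin.symm i : P) : ℕ)), ?_, ?_, ?_⟩
  · rintro (a | i) (b | j) hab
    · exact congrArg _ (h.inj hab)
    · exact (h.disj a (by rw [show l a = _ from hab]; exact hP j)).elim
    · exact (h.disj b (by rw [← show _ = l b from hab]; exact hP i)).elim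
    · exact congrArg _ (P.equivFin.symm.injective (Subtype.ext hab))
  · rintro (a | i)
    · exact h.pos a
    · exact h.pos_out _ (hP i)
  · rintro (a | i) (b | j)
    · rw [hex]
      simp only [SimpleGraph.addIsolates, SimpleGraph.sum_adj_inl, Sum.elim_inl, h.adj_iff, ne_eq,
        Sum.inl.injEq]
    all_goals
      rw [hex]
      simp only [SimpleGraph.addIsolates, SimpleGraph.sum_adj, SimpleGraph.bot_adj, Sum.elim_inl,
        Sum.elim_inr, false_iff, not_and, not_or, not_exists]
    · exact fun _ => h.out a _ (hP j)
    · rw [add_comm]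
      exact fun _ => h.out b _ (hP i)
    · refine fun hij => h.out_out _ (hP i) _ (hP j) fun he => hij ?_
      exact congrArg _ (P.equivFin.symm.injective (Subtype.ext he))

/-- A labelled graph whose two largest labels `A` and `B` are isolates can be placed below a
labelled graph that uses `A` and `B`. -/
theorem glue {A B : ℕ} (h : SumLabellingWith G l {A, B}) (hl : ∀ v, l v < B) (hBA : B < A)
    {g : W → ℕ} (h' : SumLabellingWith H g P)
    (hA : (∃ w, g w = A) ∨ A ∈ P) (hB : (∃ w, g w = B) ∨ B ∈ P)
    (hg : ∀ w, g w = A ∨ g w = B ∨ A + B ≤ g w) (hP : ∀ p ∈ P, p = A ∨ p = B ∨ A + B ≤ p)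
    (hd : ∀ x y, ((∃ w, g w = x) ∨ x ∈ P) → ((∃ w, g w = y) ∨ y ∈ P) → ∀ v, x + l v ≠ y) :
    SumLabellingWith (H ⊕g G) (Sum.elim g l) P := by
  have hgB : ∀ w, B ≤ g w := fun w => by rcases hg w with h | h | h <;> omega
  have hPB : ∀ p ∈ P, B ≤ p := fun w hw => by rcases hP w hw with h | h | h <;> omega
  refine ⟨?_, ?_, h'.pos_out, ?_, ?_, ?_, ?_⟩
  · rintro (a | a) (b | b) hab
    · exact congrArg _ (h'.inj hab)
    · have := hgB a
      have := hl b
      simp only [Sum.elim_inl, Sum.elim_inr] at hab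
      omega
    · have := hgB b
      have := hl a
      simp only [Sum.elim_inl, Sum.elim_inr] at hab
      omega
    · exact congrArg _ (h.inj hab)
  · rintro (a | a)
    · exact h'.pos a
    · exact h.pos a
  · rintro (a | a) ha
    · exact h'.disj a ha
    · have := hPB _ ha
      have := hl a
      simp only [Sum.elim_inr] at this ha
      have := hPB _ ha
      omega
  · have mixed : ∀ a b, ¬ ((∃ z, Sum.elim g l z = g a + l b) ∨ g a + l b ∈ P) := by
      rintro a b (⟨z | z, hz⟩ | hz)
      · exact hd (g a) (g z) (Or.inl ⟨_, rfl⟩) (Or.inl ⟨_, rfl⟩) b hz.symm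
      · have := hgB a
        have := hl z
        simp only [Sum.elim_inr] at hz
        omega
      · exact hd (g a) _ (Or.inl ⟨_, rfl⟩) (Or.inr hz) b rfl
    rintro (a | a) (b | b)
    · simp only [SimpleGraph.sum_adj_inl, Sum.elim_inl, h'.adj_iff, ne_eq, Sum.inl.injEq,
        Sum.exists, Sum.elim_inr]
      have : ¬ ∃ z, l z = g a + g b := by
        rintro ⟨z, hz⟩
        have := hgB a
        have := hl z
        omega
      rw [or_iff_left this]
    · simp only [SimpleGraph.sum_adj, false_iff, not_and]
      exact fun _ => mixed a b
    · simp only [SimpleGraph.sum_adj, false_iff, not_and]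
      rw [add_comm]
      exact fun _ => mixed b a
    · simp only [SimpleGraph.sum_adj_inr, Sum.elim_inr, h.adj_iff, ne_eq, Sum.inr.injEq,
        Sum.exists, Sum.elim_inl, Finset.mem_insert, Finset.mem_singleton]
      have h1 := hl a
      have h2 := hl b
      -- Sums of two lower labels are below `2B < A + B`, so the only upper labels they can hit are
      -- `A` and `B`.
      have : l a + l b = A ∨ l a + l b = B ↔ (∃ w, g w = l a + l b) ∨ l a + l b ∈ P := by
        constructor
        · rintro (h | h) <;> rw [h] <;> assumption
        · rintro (⟨w, hw⟩ | hw)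
          · have := hg w
            omega
          · have := hP _ hw
            omega
      rw [this, or_left_comm, or_assoc]
  · rintro (a | a) p hp
    · refine ⟨?_, (h'.out a p hp).2⟩
      rintro (z | z)
      · exact (h'.out a p hp).1 z
      · have := hl z
        have := hgB a
        simp only [Sum.elim_inl, Sum.elim_inr]
        omega
    · simp only [Sum.elim_inr]
      rw [add_comm]
      refine ⟨?_, fun hm => hd p _ (Or.inr hp) (Or.inr hm) a rfl⟩
      rintro (z | z) hz
      · exact hd p (g z) (Or.inr hp) (Or.inl ⟨_, rfl⟩) a hz.symm
      · have := hl z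
        have := hPB p hp
        simp only [Sum.elim_inr] at hz
        omega
  · intro p hp q hq hpq
    refine ⟨?_, (h'.out_out p hp q hq hpq).2⟩
    rintro (z | z)
    · exact (h'.out_out p hp q hq hpq).1 z
    · have := hl z
      have := hPB p hp
      simp only [Sum.elim_inr]
      omega

end SumLabellingWith

/-! ### Fibonacci-like sequences as labellings of paths and cycles. -/

/-- The Fibonacci sequence starting with `A`, `B`. -/
def gibonacci (A B : ℕ) : ℕ → ℕ
  | 0 => A
  | 1 => B
  | n + 2 => gibonacci A B n + gibonacci A B (n + 1)

namespace gibonacci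

variable {A B : ℕ}

theorem add_two (n : ℕ) :
    gibonacci A B (n + 2) = gibonacci A B n + gibonacci A B (n + 1) := rfl

theorem le_self (hBA : B < A) : ∀ n, B ≤ gibonacci A B n
  | 0 => hBA.le
  | 1 => le_rfl
  | n + 2 => (le_self hBA (n + 1)).trans (by rw [add_two]; omega)

theorem lt_succ (hB : 0 < B) (hBA : B < A) (n : ℕ) :
    gibonacci A B (n + 1) < gibonacci A B (n + 2) := by
  have := le_self hBA n
  rw [add_two]
  omega

theorem lt_of_lt (hB : 0 < B) (hBA : B < A) {i j : ℕ} (hi : 1 ≤ i) (hij : i < j) :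
    gibonacci A B i < gibonacci A B j := by
  obtain ⟨i, rfl⟩ := Nat.exists_eq_add_of_le' hi
  obtain ⟨j, rfl⟩ := Nat.exists_eq_add_of_le' (hi.trans hij.le)
  have : StrictMono fun n => gibonacci A B (n + 1) := strictMono_nat_of_lt_succ (lt_succ hB hBA)
  exact this (by omega)

theorem le_of_le (hB : 0 < B) (hBA : B < A) {i j : ℕ} (hi : 1 ≤ i) (hij : i ≤ j) :
    gibonacci A B i ≤ gibonacci A B j := by
  rcases hij.eq_or_lt with rfl | h
  · exact le_rfl
  · exact (lt_of_lt hB hBA hi h).le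

theorem add_le (hB : 0 < B) (hBA : B < A) {j : ℕ} (hj : 2 ≤ j) : A + B ≤ gibonacci A B j :=
  le_of_le (i := 2) hB hBA (by omega) hj

/-- Every earlier term is at least `B` below a term of index at least two. -/
theorem add_le_of_lt (hB : 0 < B) (hBA : B < A) {i j : ℕ} (hj : 2 ≤ j) (hij : i < j) :
    gibonacci A B i + B ≤ gibonacci A B j := by
  rcases Nat.eq_zero_or_pos i with rfl | hi
  · exact add_le hB hBA hj
  · obtain ⟨j, rfl⟩ := Nat.exists_eq_add_of_le' hj
    have := le_self hBA j
    have := le_of_le hB hBA hi (show i ≤ j + 1 by omega)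
    rw [add_two]
    omega

theorem injective (hB : 0 < B) (hBA : B < A) : Function.Injective (gibonacci A B) := by
  have key : ∀ i j, i < j → gibonacci A B i ≠ gibonacci A B j := by
    intro i j hij
    rcases Nat.lt_or_ge j 2 with hj | hj
    · obtain ⟨rfl, rfl⟩ : i = 0 ∧ j = 1 := by omega
      exact hBA.ne'
    · have := add_le_of_lt hB hBA hj hij
      omega
  intro i j h
  rcases lt_trichotomy i j with hij | hij | hij
  · exact (key i j hij h).elim
  · exact hij
  · exact (key j i hij h.symm).elim

/-- Sums of two earlier terms are at most the next term, with one exception. -/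
theorem add_le_succ (hB : 0 < B) (hBA : B < A) {i j : ℕ} (hij : i < j)
    (h : ¬ (i = 0 ∧ j = 2)) : gibonacci A B i + gibonacci A B j ≤ gibonacci A B (j + 1) := by
  obtain ⟨j, rfl⟩ := Nat.exists_eq_add_of_le' (show 1 ≤ j by omega)
  rw [add_two]
  have : gibonacci A B i ≤ gibonacci A B j := by
    rcases Nat.eq_zero_or_pos i with rfl | hi
    · rcases Nat.lt_or_ge j 2 with hj | hj
      · obtain rfl : j = 0 := by omega
        exact le_rfl
      · have := add_le hB hBA hj
        simp only [gibonacci]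
        omega
    · exact le_of_le hB hBA hi (by omega)
  omega

/-- The only sums of two distinct terms that are terms again are those of the recursion. -/
theorem add_eq (hB : 0 < B) (hBA : B < A) {i j k : ℕ} (hij : i < j)
    (h : gibonacci A B i + gibonacci A B j = gibonacci A B k) : j = i + 1 ∧ k = i + 2 := by
  have hi := le_self hBA i
  have hj := le_self hBA j
  have hk : 2 ≤ k := by
    by_contra hk
    rcases Nat.lt_or_ge j 2 with hj2 | hj2
    · obtain ⟨rfl, rfl⟩ : i = 0 ∧ j = 1 := by omega
      obtain rfl | rfl : k = 0 ∨ k = 1 := by omega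
      all_goals simp only [gibonacci] at h; omega
    · have := add_le hB hBA hj2
      obtain rfl | rfl : k = 0 ∨ k = 1 := by omega
      all_goals simp only [gibonacci] at h; omega
  have hjk : j < k := by
    by_contra hjk
    have := le_of_le hB hBA (by omega) (show k ≤ j by omega)
    omega
  -- The exceptional sum `A + (A + B)` lies strictly between the terms `A + 2B` and `2A + 3B` of
  -- index 3 and 4.
  by_cases h2 : i = 0 ∧ j = 2
  · obtain ⟨rfl, rfl⟩ := h2
    rcases Nat.lt_or_ge k 4 with hk4 | hk4
    · obtain rfl : k = 3 := by omega
      simp only [gibonacci] at h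
      omega
    · have := le_of_le hB hBA (by omega) hk4
      simp only [gibonacci] at h this
      omega
  · have h3 := add_le_succ hB hBA hij h2
    have hkj : k = j + 1 := by
      by_contra hkj
      have := lt_of_lt hB hBA (show 1 ≤ j + 1 by omega) (show j + 1 < k by omega)
      omega
    subst hkj
    obtain ⟨j, rfl⟩ := Nat.exists_eq_add_of_le' (show 1 ≤ j by omega)
    rw [add_two] at h
    have := injective hB hBA (show gibonacci A B i = gibonacci A B j by omega)
    omega

end gibonacci

namespace gibonacci

variable {A B : ℕ}

theorem eq_or_add_le (hB : 0 < B) (hBA : B < A) (i : ℕ) :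
    gibonacci A B i = A ∨ gibonacci A B i = B ∨ A + B ≤ gibonacci A B i := by
  match i with
  | 0 => exact Or.inl rfl
  | 1 => exact Or.inr (Or.inl rfl)
  | i + 2 => exact Or.inr (Or.inr (add_le hB hBA (by omega)))

theorem le_of_index_le (hB : 0 < B) (hBA : B < A) {i j : ℕ} (hj : 2 ≤ j) (hij : i ≤ j) :
    gibonacci A B i ≤ gibonacci A B j := by
  rcases hij.eq_or_lt with rfl | h
  · exact le_rfl
  · have := add_le_of_lt hB hBA hj h
    omega

/-- From index 2 on, each term exceeds all earlier ones by at least `B`. The only positive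
difference of two terms that can be below `B` is therefore `A - B`, which `h` rules out. -/
theorem add_small_ne (hB : 0 < B) (hBA : B < A) {v : ℕ} (hv : 0 < v) (hvB : v < B)
    (h : B + v ≠ A) (i j : ℕ) : gibonacci A B i + v ≠ gibonacci A B j := by
  rcases Nat.lt_or_ge j 2 with hj | hj
  · have := eq_or_add_le hB hBA i
    obtain rfl | rfl : j = 0 ∨ j = 1 := by omega
    all_goals simp only [gibonacci]; omega
  · rcases Nat.lt_or_ge i j with hij | hij
    · have := add_le_of_lt hB hBA hj hij
      omega
    · have := le_of_index_le hB hBA (hj.trans hij) hij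
      omega

theorem sumLabellingWith_pathGraph (hB : 0 < B) (hBA : B < A) {n : ℕ} (hn : 2 ≤ n) :
    SumLabellingWith (SimpleGraph.pathGraph n) (fun i => gibonacci A B i) {gibonacci A B n} := by
  have hpos : ∀ i, 0 < gibonacci A B i := fun i => hB.trans_le (le_self hBA i)
  have key : ∀ i j : Fin n, i < j →
      ((i : ℕ) + 1 = j ↔ (∃ z : Fin n, gibonacci A B z = gibonacci A B i + gibonacci A B j) ∨
        gibonacci A B i + gibonacci A B j = gibonacci A B n) := by
    intro i j hij
    constructor
    · intro h
      rw [← h, ← add_two]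
      rcases Nat.lt_or_ge (i + 2) n with h2 | h2
      · exact Or.inl ⟨⟨i + 2, h2⟩, rfl⟩
      · have : (i : ℕ) + 2 = n := by omega
        rw [this]
        exact Or.inr rfl
    · rintro (⟨z, hz⟩ | hz)
      · have := add_eq hB hBA hij hz.symm
        omega
      · have := add_eq hB hBA hij hz
        omega
  refine ⟨fun i j h => Fin.ext (injective hB hBA h), fun i => hpos i, ?_, ?_, ?_, ?_, ?_⟩
  · simp [hpos]
  · intro i hi
    have := injective hB hBA (Finset.mem_singleton.1 hi)
    omega
  · intro i j
    simp only [Finset.mem_singleton, SimpleGraph.pathGraph_adj]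
    rcases lt_trichotomy i j with hij | rfl | hij
    · rw [← key i j hij]
      have := hij.ne
      omega
    · simp
    · rw [add_comm (gibonacci A B i), ← key j i hij]
      have := hij.ne'
      omega
  · intro i p hp
    rw [Finset.mem_singleton.1 hp, Finset.mem_singleton]
    have := hpos i
    refine ⟨fun z => ?_, by omega⟩
    have := le_of_index_le hB hBA hn z.2.le
    omega
  · intro p hp q hq hpq
    rw [Finset.mem_singleton] at hp hq
    exact (hpq (hp.trans hq.symm)).elim

end gibonacci

theorem SimpleGraph.cycleGraph_add_three_adj {m : ℕ} {i j : Fin (m + 3)} (hij : i < j) :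
    (SimpleGraph.cycleGraph (m + 3)).Adj i j ↔
      (i : ℕ) + 1 = j ∨ ((i : ℕ) = 0 ∧ (j : ℕ) = m + 2) := by
  rw [SimpleGraph.cycleGraph_adj', Fin.sub_val_of_le hij.le, Fin.coe_sub_iff_lt.2 hij]
  have : (i : ℕ) < j := hij
  omega

namespace gibonacci

variable {A B : ℕ}

/-- The second isolate realises the closing edge between the first and the last vertex. The danger
is that the two isolates differ by a label; their difference is that of `A` and the term of index `m
+ 1`. For `m = 1` it is `B`, which is why the four-cycle is excluded. -/
theorem sumLabellingWith_cycleGraph (hB : 0 < B) (hBA : B < A) (hA : A ≠ 2 * B) {m : ℕ}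
    (hm : m ≠ 1) :
    SumLabellingWith (SimpleGraph.cycleGraph (m + 3)) (fun i => gibonacci A B i)
      {gibonacci A B (m + 3), A + gibonacci A B (m + 2)} := by
  have hpos : ∀ i, 0 < gibonacci A B i := fun i => hB.trans_le (le_self hBA i)
  have hle : ∀ i : Fin (m + 3), gibonacci A B i ≤ gibonacci A B (m + 2) := fun i =>
    le_of_index_le hB hBA (by omega) (by omega)
  have hlt : gibonacci A B (m + 2) < gibonacci A B (m + 3) :=
    lt_of_lt hB hBA (by omega) (by omega)
  have key : ∀ i j : Fin (m + 3), i < j →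
      ((i : ℕ) + 1 = j ∨ ((i : ℕ) = 0 ∧ (j : ℕ) = m + 2) ↔
        (∃ z : Fin (m + 3), gibonacci A B z = gibonacci A B i + gibonacci A B j) ∨
        gibonacci A B i + gibonacci A B j = gibonacci A B (m + 3) ∨
        gibonacci A B i + gibonacci A B j = A + gibonacci A B (m + 2)) := by
    intro i j hij
    constructor
    · rintro (h | ⟨h1, h2⟩)
      · rw [← h, ← add_two]
        rcases Nat.lt_or_ge (i + 2) (m + 3) with h2 | h2
        · exact Or.inl ⟨⟨i + 2, h2⟩, rfl⟩
        · have : (i : ℕ) + 2 = m + 3 := by omega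
          rw [this]
          exact Or.inr (Or.inl rfl)
      · rw [h1, h2]
        exact Or.inr (Or.inr rfl)
    · rintro (⟨z, hz⟩ | hz | hz)
      · exact Or.inl (add_eq hB hBA hij hz.symm).1.symm
      · exact Or.inl (add_eq hB hBA hij hz).1.symm
      · right
        rcases Nat.lt_or_ge j (m + 2) with hj | hj
        · exfalso
          by_cases h02 : (i : ℕ) = 0 ∧ (j : ℕ) = 2
          · rw [h02.1, h02.2] at hz
            have := injective hB hBA (show gibonacci A B 2 = gibonacci A B (m + 2) from
              Nat.add_left_cancel hz)
            omega
          · have := add_le_succ hB hBA hij h02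
            have := le_of_index_le hB hBA (j := m + 2) (by omega) (show (j : ℕ) + 1 ≤ _ from hj)
            omega
        · have hj' : (j : ℕ) = m + 2 := by omega
          rw [hj'] at hz
          exact ⟨injective hB hBA (Nat.add_right_cancel hz), hj'⟩
  have hrec : gibonacci A B (m + 3) = gibonacci A B (m + 1) + gibonacci A B (m + 2) := rfl
  have h12 : ∀ i, gibonacci A B i + gibonacci A B (m + 1) ≠ A := by
    intro i hi
    rcases Nat.eq_zero_or_pos m with rfl | hm0
    -- For the triangle the term of index `m + 1` is `B`, and `A - B` is a label only if `A = 2B`.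
    · simp only [gibonacci] at hi
      have := eq_or_add_le hB hBA i
      omega
    · have := add_le hB hBA (show 2 ≤ m + 1 by omega)
      omega
  have h21 : ∀ i, gibonacci A B i + A ≠ gibonacci A B (m + 1) := by
    intro i hi
    rcases Nat.eq_zero_or_pos i with rfl | hi0
    -- `2A` equals the term of index `m + 1` only for `m = 2`, where that term is `A + 2B`, and then
    -- `A = 2B`. From index 4 on the terms are at least `2A + 3B`.
    · match m, hm with
      | 0, _ => simp only [gibonacci] at hi; omega
      | 2, _ => simp only [gibonacci] at hi; omega
      | m + 3, _ =>
        have := le_of_index_le hB hBA (j := m + 4) (by omega) (show 4 ≤ m + 4 by omega)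
        simp only [gibonacci] at hi this
        omega
    · have := add_eq hB hBA hi0 (show gibonacci A B 0 + gibonacci A B i = _ by
        rw [add_comm]; exact hi)
      omega
  refine ⟨fun i j h => Fin.ext (injective hB hBA h), fun i => hpos i, ?_, ?_, ?_, ?_, ?_⟩
  · simp only [Finset.mem_insert, Finset.mem_singleton]
    rintro p (rfl | rfl)
    · exact hpos _
    · omega
  · intro i hi
    have := hle i
    simp only [Finset.mem_insert, Finset.mem_singleton] at hi
    omega
  · intro i j
    simp only [Finset.mem_singleton, Finset.mem_insert]
    rcases lt_trichotomy i j with hij | rfl | hij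
    · rw [← key i j hij, SimpleGraph.cycleGraph_add_three_adj hij, and_iff_right hij.ne]
    · simp
    · rw [add_comm (gibonacci A B i), ← key j i hij, SimpleGraph.adj_comm,
        SimpleGraph.cycleGraph_add_three_adj hij, and_iff_right hij.ne']
  · intro i p hp
    have h1 := h12 i
    have h2 := h21 i
    have h3 := hpos i
    simp only [Finset.mem_insert, Finset.mem_singleton] at hp ⊢
    refine ⟨fun z => ?_, by omega⟩
    have := hle z
    omega
  · intro p hp q hq hpq
    simp only [Finset.mem_insert, Finset.mem_singleton] at hp hq ⊢
    refine ⟨fun z => ?_, by omega⟩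
    have := hle z
    omega

end gibonacci

/-! ### Stacking a path or a cycle on top of a labelled graph. -/

/-- A sum labelling of `G` with one isolate, which carries the largest label. -/
structure OneOutLabelling {V : Type*} (G : SimpleGraph V) (l : V → ℕ) (A : ℕ) : Prop where
  labelling : SumLabellingWith G l {A}
  lt : ∀ v, l v < A

/-- A sum labelling of `G` with two isolates, which carry the two largest labels. -/
structure TwoOutLabelling {V : Type*} (G : SimpleGraph V) (l : V → ℕ) (A B : ℕ) : Prop where
  labelling : SumLabellingWith G l {A, B}
  lt : ∀ v, l v < B
  lt_out : B < A
  ne_out : A ≠ 2 * B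

section

variable {V : Type*} {G : SimpleGraph V} {l : V → ℕ} {A B : ℕ}

theorem TwoOutLabelling.pos (h : TwoOutLabelling G l A B) : 0 < B :=
  h.labelling.pos_out B (by simp)

theorem TwoOutLabelling.add_ne (h : TwoOutLabelling G l A B) (v : V) : B + l v ≠ A := by
  have := (h.labelling.out v B (by simp)).2
  simp only [Finset.mem_insert, not_or] at this
  omega

/-- A surplus isolate supplies the second seed for the next component. All sums of two distinct old
labels are below `2A`, so `4A` is out of their reach, and it also avoids the forbidden value `2A`.
-/
theorem OneOutLabelling.twoOut (h : OneOutLabelling G l A) : TwoOutLabelling G l (4 * A) A := by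
  have hA : 0 < A := h.labelling.pos_out A (by simp)
  have hl := h.lt
  have h1 := h.labelling.out
  refine ⟨⟨h.labelling.inj, h.labelling.pos, ?_, ?_, ?_, ?_, ?_⟩, h.lt, by omega, by omega⟩
  · simp only [Finset.mem_insert, Finset.mem_singleton]
    omega
  · intro v
    have := hl v
    simp only [Finset.mem_insert, Finset.mem_singleton]
    omega
  · intro x y
    have := hl x
    have := hl y
    rw [h.labelling.adj_iff]
    simp only [Finset.mem_insert, Finset.mem_singleton]
    rw [or_iff_right (a := l x + l y = 4 * A) (by omega)]
  · intro v p hp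
    have := h.labelling.pos v
    have := hl v
    simp only [Finset.mem_insert, Finset.mem_singleton] at hp ⊢
    refine ⟨fun z => ?_, by omega⟩
    have := hl z
    omega
  · intro p hp q hq hpq
    simp only [Finset.mem_insert, Finset.mem_singleton] at hp hq ⊢
    refine ⟨fun z => ?_, by omega⟩
    have := hl z
    omega

theorem TwoOutLabelling.path (h : TwoOutLabelling G l A B) {n : ℕ} (hn : 2 ≤ n) :
    OneOutLabelling (SimpleGraph.pathGraph n ⊕g G)
      (Sum.elim (fun i => gibonacci A B i) l) (gibonacci A B n) := by
  have hB := h.pos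
  have hBA := h.lt_out
  constructor
  · refine h.labelling.glue h.lt hBA (gibonacci.sumLabellingWith_pathGraph hB hBA hn)
      (Or.inl ⟨⟨0, by omega⟩, rfl⟩) (Or.inl ⟨⟨1, by omega⟩, rfl⟩)
      (fun w => gibonacci.eq_or_add_le hB hBA w) ?_ ?_
    · simpa using gibonacci.eq_or_add_le hB hBA n
    · simp only [Finset.mem_singleton]
      have key : ∀ i j v, gibonacci A B i + l v ≠ gibonacci A B j := fun i j v =>
        gibonacci.add_small_ne hB hBA (h.labelling.pos v) (h.lt v) (h.add_ne v) i j
      rintro x y (⟨i, rfl⟩ | rfl) (⟨j, rfl⟩ | rfl) v <;> exact key _ _ v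
  · rintro (i | v)
    · have := gibonacci.add_le_of_lt hB hBA hn i.2
      simp only [Sum.elim_inl]
      omega
    · have := gibonacci.add_le hB hBA hn
      have := h.lt v
      simp only [Sum.elim_inr]
      omega

theorem TwoOutLabelling.cycle (h : TwoOutLabelling G l A B) {m : ℕ} (hm : m ≠ 1) :
    ∃ A' B', {A', B'} = ({gibonacci A B (m + 3), A + gibonacci A B (m + 2)} : Finset ℕ) ∧
      TwoOutLabelling (SimpleGraph.cycleGraph (m + 3) ⊕g G)
        (Sum.elim (fun i => gibonacci A B i) l) A' B' := by
  have hB := h.pos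
  have hBA := h.lt_out
  have hrec : gibonacci A B (m + 3) = gibonacci A B (m + 1) + gibonacci A B (m + 2) := rfl
  have hle : ∀ i : Fin (m + 3), gibonacci A B i ≤ gibonacci A B (m + 2) := fun i =>
    gibonacci.le_of_index_le hB hBA (by omega) (by omega)
  have hmax := gibonacci.add_le hB hBA (show 2 ≤ m + 2 by omega)
  have hlt : gibonacci A B (m + 1) < gibonacci A B (m + 2) :=
    gibonacci.lt_of_lt hB hBA (by omega) (by omega)
  have hpos : 0 < gibonacci A B (m + 1) := hB.trans_le (gibonacci.le_self hBA _)
  have hlab : SumLabellingWith (SimpleGraph.cycleGraph (m + 3) ⊕g G)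
      (Sum.elim (fun i => gibonacci A B i) l)
      {gibonacci A B (m + 3), A + gibonacci A B (m + 2)} := by
    refine h.labelling.glue h.lt hBA
      (gibonacci.sumLabellingWith_cycleGraph hB hBA h.ne_out hm)
      (Or.inl ⟨⟨0, by omega⟩, rfl⟩) (Or.inl ⟨⟨1, by omega⟩, rfl⟩)
      (fun w => gibonacci.eq_or_add_le hB hBA w) ?_ ?_
    · simp only [Finset.mem_insert, Finset.mem_singleton]
      omega
    · simp only [Finset.mem_insert, Finset.mem_singleton]
      have key : ∀ i j v, gibonacci A B i + l v ≠ gibonacci A B j := fun i j v =>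
        gibonacci.add_small_ne hB hBA (h.labelling.pos v) (h.lt v) (h.add_ne v) i j
      rintro x y (⟨i, rfl⟩ | rfl | rfl) (⟨j, rfl⟩ | rfl | rfl) v
      · exact key _ _ v
      · exact key _ _ v
      · have := hle i
        have := h.lt v
        omega
      · exact key _ _ v
      · exact key _ _ v
      · have : _ ≠ A := key (m + 1) 0 v
        omega
      · have := hle j
        omega
      · have : A + _ ≠ _ := key 0 (m + 1) v
        omega
      · have := h.labelling.pos v
        omega
  have hne : gibonacci A B (m + 1) ≠ A := by
    intro he
    have := gibonacci.injective hB hBA (show _ = gibonacci A B 0 from he)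
    omega
  have hlt' : ∀ v, Sum.elim (fun i : Fin (m + 3) => gibonacci A B i) l v <
      gibonacci A B (m + 3) ∧ Sum.elim (fun i : Fin (m + 3) => gibonacci A B i) l v <
      A + gibonacci A B (m + 2) := by
    rintro (i | v)
    · have := hle i
      simp only [Sum.elim_inl]
      omega
    · have := h.lt v
      simp only [Sum.elim_inr]
      omega
  -- Either isolate can be the larger: for a triangle the term of index `m + 1` is `B < A`, for
  -- longer cycles it exceeds `A`.
  rcases lt_or_gt_of_ne hne with hlt2 | hlt2
  · exact ⟨A + gibonacci A B (m + 2), gibonacci A B (m + 3), Finset.pair_comm _ _,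
      Finset.pair_comm (gibonacci A B (m + 3)) _ ▸ hlab, fun v => (hlt' v).1, by omega, by omega⟩
  · exact ⟨gibonacci A B (m + 3), A + gibonacci A B (m + 2), rfl, hlab, fun v => (hlt' v).2,
      by omega, by omega⟩

end

/-! ### Parallelograms among the labels, and adding four-cycles. -/

/-- A parallelogram `p`, `p + s`, `p + t`, `p + s + t` in a set of positive integers whose side
lengths do not belong to the set. -/
def HasQuad (L : Set ℕ) : Prop :=
  ∃ p s t, 0 < p ∧ 0 < s ∧ 0 < t ∧ p ∈ L ∧ p + s ∈ L ∧ p + t ∈ L ∧ p + s + t ∈ L ∧ s ∉ L ∧ t ∉ L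

/-- The sides `s` and `t` are smaller than the corners `p + s` and `p + t`, so they cannot be among
new labels that exceed all old ones. -/
theorem HasQuad.mono {L L' : Set ℕ} (h : HasQuad L) (hL : L ⊆ L')
    (hL' : ∀ n ∈ L', n ∈ L ∨ ∀ m ∈ L, m < n) : HasQuad L' := by
  obtain ⟨p, s, t, hp, hs, ht, h1, h2, h3, h4, h5, h6⟩ := h
  refine ⟨p, s, t, hp, hs, ht, hL h1, hL h2, hL h3, hL h4, fun h => ?_, fun h => ?_⟩
  · have := (hL' s h).resolve_left h5 _ h2
    omega
  · have := (hL' t h).resolve_left h6 _ h3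
    omega

/-- All labels used by a labelling with isolates. -/
def labelSet {V : Type*} (l : V → ℕ) (P : Finset ℕ) : Set ℕ := {n | (∃ z, l z = n) ∨ n ∈ P}

/-- A four-cycle can be added to a labelled graph which has a quad among its labels. -/
theorem SumLabellingWith.add_cycleGraph_four {V : Type*} {G : SimpleGraph V} {l : V → ℕ}
    {P : Finset ℕ} (h : SumLabellingWith G l P) {p s t : ℕ} (hp : 0 < p) (hs : 0 < s) (ht : 0 < t)
    (h1 : p ∈ labelSet l P) (h2 : p + s ∈ labelSet l P) (h3 : p + t ∈ labelSet l P)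
    (h4 : p + s + t ∈ labelSet l P) (h5 : s ∉ labelSet l P) (h6 : t ∉ labelSet l P) :
    SumLabellingWith (SimpleGraph.cycleGraph 4 ⊕g G)
      (Sum.elim ![1, 10 * p - 1, 10 * t + 1, 10 * (p + s) - 1] (fun v => 10 * l v))
      (P.image (10 * ·)) := by
  -- Going round the cycle, the edge sums are 10 times `p`, `p + t`, `p + s + t`, `p + s`. The two
  -- diagonals have sums congruent to 2 and 8 modulo 10, which no label is.
  set c : Fin 4 → ℕ := ![1, 10 * p - 1, 10 * t + 1, 10 * (p + s) - 1] with hc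
  have c0 : c 0 = 1 := rfl
  have c1 : c 1 = 10 * p - 1 := rfl
  have c2 : c 2 = 10 * t + 1 := rfl
  have c3 : c 3 = 10 * (p + s) - 1 := rfl
  have hL : ∀ n, ((∃ z, Sum.elim c (fun v => 10 * l v) z = n) ∨ n ∈ P.image (10 * ·)) ↔
      (∃ i, c i = n) ∨ ∃ m ∈ labelSet l P, 10 * m = n := by
    intro n
    simp only [Sum.exists, Sum.elim_inl, Sum.elim_inr, Finset.mem_image, labelSet,
      Set.mem_ofPred_eq, or_assoc, or_and_right, exists_or, exists_exists_eq_and]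
  have hnot : ∀ n, ¬ ((∃ z, Sum.elim c (fun v => 10 * l v) z = n) ∨ n ∈ P.image (10 * ·)) →
      (∀ z, Sum.elim c (fun v => 10 * l v) z ≠ n) ∧ n ∉ P.image (10 * ·) := by
    intro n hn
    rw [not_or, not_exists] at hn
    exact hn
  have hcm : ∀ i, c i % 10 = 1 ∨ c i % 10 = 9 := by
    intro i
    fin_cases i
    · exact Or.inl rfl
    · change c 1 % 10 = 1 ∨ c 1 % 10 = 9
      omega
    · change c 2 % 10 = 1 ∨ c 2 % 10 = 9
      omega
    · change c 3 % 10 = 1 ∨ c 3 % 10 = 9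
      omega
  -- Two distinct labels of the four-cycle that agree modulo 10 differ by `10 * t` or `10 * s`.
  -- Since `s` and `t` are not old labels, no edge arises between the cycle and the rest.
  have hmixed : ∀ i, ∀ n ∈ labelSet l P, 0 < n → ¬ ((∃ z, Sum.elim c (fun v => 10 * l v) z =
      c i + 10 * n) ∨ c i + 10 * n ∈ P.image (10 * ·)) := by
    intro i n hn hn0
    have hns : n ≠ s := fun h => h5 (h ▸ hn)
    have hnt : n ≠ t := fun h => h6 (h ▸ hn)
    rw [hL]
    rintro (⟨j, hj⟩ | ⟨m, -, hm⟩)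
    · have hi : c i = c 0 ∨ c i = c 1 ∨ c i = c 2 ∨ c i = c 3 := by fin_cases i <;> simp
      have hj' : c j = c 0 ∨ c j = c 1 ∨ c j = c 2 ∨ c j = c 3 := by fin_cases j <;> simp
      omega
    · have := hcm i
      omega
  have hbase : ∀ m, (∃ z, Sum.elim c (fun v => 10 * l v) z = 10 * m) ∨
      10 * m ∈ P.image (10 * ·) ↔ m ∈ labelSet l P := by
    intro m
    rw [hL]
    constructor
    · rintro (⟨j, hj⟩ | ⟨n, hn, hm⟩)
      · have := hcm j
        omega
      · obtain rfl : n = m := by omega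
        exact hn
    · exact fun hm => Or.inr ⟨m, hm, rfl⟩
  refine ⟨?_, ?_, ?_, ?_, ?_, ?_, ?_⟩
  · rintro (i | a) (j | b) hab
    · refine congrArg _ ?_
      change c i = c j at hab
      fin_cases i <;> fin_cases j <;> first | rfl | (exfalso; simp [hc] at hab; omega)
    · have := hcm i
      simp only [Sum.elim_inl, Sum.elim_inr] at hab
      omega
    · have := hcm j
      simp only [Sum.elim_inl, Sum.elim_inr] at hab
      omega
    · refine congrArg _ (h.inj ?_)
      simp only [Sum.elim_inr] at hab
      omega
  · rintro (i | a)
    · have := hcm i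
      simp only [Sum.elim_inl]
      omega
    · have := h.pos a
      simp only [Sum.elim_inr]
      omega
  · simp only [Finset.mem_image]
    rintro _ ⟨q, hq, rfl⟩
    have := h.pos_out q hq
    omega
  · simp only [Finset.mem_image]
    rintro (i | a) ⟨q, hq, hq'⟩
    · have := hcm i
      simp only [Sum.elim_inl] at hq'
      omega
    · simp only [Sum.elim_inr] at hq'
      obtain rfl : q = l a := by omega
      exact h.disj a hq
  · rintro (i | a) (j | b)
    · rw [SimpleGraph.sum_adj_inl, ne_eq, Sum.inl.injEq]
      simp only [Sum.elim_inl]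
      have no2 : ∀ n, n % 10 = 2 ∨ n % 10 = 8 →
          ¬ ((∃ z, Sum.elim c (fun v => 10 * l v) z = n) ∨ n ∈ P.image (10 * ·)) := by
        intro n hn
        rw [hL]
        rintro (⟨j, hj⟩ | ⟨m, -, hm⟩)
        · have := hcm j
          omega
        · omega
      have yes : ∀ n m, n = 10 * m → m ∈ labelSet l P →
          ((∃ z, Sum.elim c (fun v => 10 * l v) z = n) ∨ n ∈ P.image (10 * ·)) := by
        rintro n m rfl hm
        exact (hbase m).2 hm
      have q01 : c 0 + c 1 = 10 * p := by omega
      have q12 : c 1 + c 2 = 10 * (p + t) := by omega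
      have q23 : c 2 + c 3 = 10 * (p + s + t) := by omega
      have q30 : c 3 + c 0 = 10 * (p + s) := by omega
      have n02 := no2 (c 0 + c 2) (by omega)
      have n13 := no2 (c 1 + c 3) (by omega)
      have n20 := no2 (c 2 + c 0) (by omega)
      have n31 := no2 (c 3 + c 1) (by omega)
      have e01 := yes _ _ q01 h1
      have e12 := yes _ _ q12 h3
      have e23 := yes _ _ q23 h4
      have e30 := yes _ _ q30 h2
      have e10 := yes _ _ ((add_comm _ _).trans q01) h1
      have e21 := yes _ _ ((add_comm _ _).trans q12) h3
      have e32 := yes _ _ ((add_comm _ _).trans q23) h4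
      have e03 := yes _ _ ((add_comm _ _).trans q30) h2
      fin_cases i <;> fin_cases j
      · simp
      · exact iff_of_true (by decide) ⟨by decide, e01⟩
      · exact iff_of_false (by decide) fun hh => n02 hh.2
      · exact iff_of_true (by decide) ⟨by decide, e03⟩
      · exact iff_of_true (by decide) ⟨by decide, e10⟩
      · simp
      · exact iff_of_true (by decide) ⟨by decide, e12⟩
      · exact iff_of_false (by decide) fun hh => n13 hh.2
      · exact iff_of_false (by decide) fun hh => n20 hh.2
      · exact iff_of_true (by decide) ⟨by decide, e21⟩
      · simp
      · exact iff_of_true (by decide) ⟨by decide, e23⟩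
      · exact iff_of_true (by decide) ⟨by decide, e30⟩
      · exact iff_of_false (by decide) fun hh => n31 hh.2
      · exact iff_of_true (by decide) ⟨by decide, e32⟩
      · simp
    · simp only [SimpleGraph.sum_adj, Sum.elim_inl, Sum.elim_inr]
      exact iff_of_false (by simp) fun hh => hmixed i _ (Or.inl ⟨b, rfl⟩) (h.pos b) hh.2
    · simp only [SimpleGraph.sum_adj, Sum.elim_inl, Sum.elim_inr]
      rw [add_comm (10 * l a)]
      exact iff_of_false (by simp) fun hh => hmixed j _ (Or.inl ⟨a, rfl⟩) (h.pos a) hh.2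
    · rw [SimpleGraph.sum_adj_inr, ne_eq, Sum.inr.injEq, h.adj_iff]
      simp only [Sum.elim_inr]
      rw [← mul_add, hbase]
      rfl
  · simp only [Finset.forall_mem_image]
    rintro (i | a) q hq
    · exact hnot _ (hmixed i q (Or.inr hq) (h.pos_out q hq))
    · refine hnot _ ?_
      simp only [Sum.elim_inr]
      rw [← mul_add, hbase]
      rintro (⟨z, hz⟩ | hz)
      · exact (h.out a q hq).1 z hz
      · exact (h.out a q hq).2 hz
  · simp only [Finset.forall_mem_image]
    intro q hq r hr hqr
    refine hnot _ ?_
    rw [← mul_add, hbase]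
    have hqr' : q ≠ r := fun hh => hqr (by rw [hh])
    rintro (⟨z, hz⟩ | hz)
    · exact (h.out_out q hq r hr hqr').1 z hz
    · exact (h.out_out q hq r hr hqr').2 hz

/-- There is a sum labelling with a quad and one isolate, which carries the largest label. -/
def HasQuadOneOut {V : Type*} (G : SimpleGraph V) : Prop :=
  ∃ l A, OneOutLabelling G l A ∧ HasQuad (labelSet l {A})

/-- There is a sum labelling with a quad and two isolates, which carry the largest labels. -/
def HasQuadTwoOut {V : Type*} (G : SimpleGraph V) : Prop :=
  ∃ l A B, TwoOutLabelling G l A B ∧ HasQuad (labelSet l {A, B})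

section

variable {V W : Type*} {G : SimpleGraph V} {H : SimpleGraph W}

theorem labelSet_comp_equiv (l : V → ℕ) (P : Finset ℕ) (e : W ≃ V) :
    labelSet (l ∘ e) P = labelSet l P := by
  ext n
  simp only [labelSet, Set.mem_ofPred_eq, Function.comp]
  rw [← e.surjective.exists (p := fun z => l z = n)]

theorem OneOutLabelling.comp_iso {l : V → ℕ} {A : ℕ} (h : OneOutLabelling G l A) (e : H ≃g G) :
    OneOutLabelling H (l ∘ e) A :=
  ⟨h.labelling.comp_iso e, fun _ => h.lt _⟩

theorem TwoOutLabelling.comp_iso {l : V → ℕ} {A B : ℕ} (h : TwoOutLabelling G l A B)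
    (e : H ≃g G) : TwoOutLabelling H (l ∘ e) A B :=
  ⟨h.labelling.comp_iso e, fun _ => h.lt _, h.lt_out, h.ne_out⟩

theorem HasQuadOneOut.of_iso (h : HasQuadOneOut G) (e : H ≃g G) : HasQuadOneOut H := by
  obtain ⟨l, A, h, hq⟩ := h
  exact ⟨l ∘ e, A, h.comp_iso e, by rwa [← labelSet_comp_equiv l _ e.toEquiv] at hq⟩

theorem HasQuadTwoOut.of_iso (h : HasQuadTwoOut G) (e : H ≃g G) : HasQuadTwoOut H := by
  obtain ⟨l, A, B, h, hq⟩ := h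
  exact ⟨l ∘ e, A, B, h.comp_iso e, by rwa [← labelSet_comp_equiv l _ e.toEquiv] at hq⟩

theorem HasQuadOneOut.isSumGraph (h : HasQuadOneOut G) : (G.addIsolates 1).IsSumGraph := by
  obtain ⟨l, A, h, -⟩ := h
  exact h.labelling.isSumGraph

theorem HasQuadTwoOut.isSumGraph (h : HasQuadTwoOut G) : (G.addIsolates 2).IsSumGraph := by
  obtain ⟨l, A, B, h, -⟩ := h
  have := h.labelling.isSumGraph
  rwa [Finset.card_pair h.lt_out.ne'] at this

theorem HasQuadOneOut.twoOut (h : HasQuadOneOut G) : HasQuadTwoOut G := by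
  obtain ⟨l, A, h, hq⟩ := h
  have hA : 0 < A := h.labelling.pos_out A (by simp)
  refine ⟨l, 4 * A, A, h.twoOut, hq.mono ?_ ?_⟩
  · rintro n (hn | hn)
    · exact Or.inl hn
    · exact Or.inr (Finset.mem_insert_of_mem hn)
  · rintro n (hn | hn)
    · exact Or.inl (Or.inl hn)
    · rcases Finset.mem_insert.1 hn with rfl | hn
      · right
        rintro m (⟨v, rfl⟩ | hm)
        · have := h.lt v
          omega
        · rw [Finset.mem_singleton] at hm
          omega
      · exact Or.inl (Or.inr hn)

/-- Stacking introduces only labels of size at least `A + B`, above all earlier ones; `A` and `B`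
themselves were labels already. Hence `HasQuad.mono` applies. -/
theorem HasQuad.glue {l : V → ℕ} {A B : ℕ} (hl : ∀ v, l v < B) (hB : 0 < B) (hBA : B < A)
    (hq : HasQuad (labelSet l {A, B})) {g : W → ℕ} {P : Finset ℕ}
    (hA : (∃ w, g w = A) ∨ A ∈ P) (hB' : (∃ w, g w = B) ∨ B ∈ P)
    (hg : ∀ w, g w = A ∨ g w = B ∨ A + B ≤ g w) (hP : ∀ p ∈ P, p = A ∨ p = B ∨ A + B ≤ p) :
    HasQuad (labelSet (Sum.elim g l) P) := by
  have hmax : ∀ m ∈ labelSet l {A, B}, m < A + B := by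
    rintro m (⟨v, rfl⟩ | hm)
    · have := hl v
      omega
    · simp only [Finset.mem_insert, Finset.mem_singleton] at hm
      omega
  have hout : ∀ n, n = A ∨ n = B → n ∈ labelSet l {A, B} := fun n hn =>
    Or.inr (by simpa using hn)
  refine hq.mono ?_ ?_
  · rintro n (⟨v, hv⟩ | hn)
    · exact Or.inl ⟨Sum.inr v, hv⟩
    · simp only [Finset.mem_insert, Finset.mem_singleton] at hn
      have key : (∃ w, g w = n) ∨ n ∈ P := by rcases hn with rfl | rfl <;> assumption
      rcases key with ⟨w, hw⟩ | hn
      · exact Or.inl ⟨Sum.inl w, hw⟩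
      · exact Or.inr hn
  · have key : ∀ n, n = A ∨ n = B ∨ A + B ≤ n →
        n ∈ labelSet l {A, B} ∨ ∀ m ∈ labelSet l {A, B}, m < n := by
      intro n hn
      rw [← or_assoc] at hn
      exact hn.imp (hout n) fun hn m hm => (hmax m hm).trans_le hn
    rintro n (⟨w | v, rfl⟩ | hn)
    · exact key _ (hg w)
    · exact Or.inl (Or.inl ⟨v, rfl⟩)
    · exact key n (hP n hn)

theorem HasQuadTwoOut.path (h : HasQuadTwoOut G) {n : ℕ} (hn : 2 ≤ n) :
    HasQuadOneOut (SimpleGraph.pathGraph n ⊕g G) := by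
  obtain ⟨l, A, B, h, hq⟩ := h
  refine ⟨_, _, h.path hn, hq.glue h.lt h.pos h.lt_out
    (Or.inl ⟨⟨0, by omega⟩, rfl⟩) (Or.inl ⟨⟨1, by omega⟩, rfl⟩)
    (fun w => gibonacci.eq_or_add_le h.pos h.lt_out w) ?_⟩
  simpa using gibonacci.eq_or_add_le h.pos h.lt_out n

theorem HasQuadTwoOut.cycle (h : HasQuadTwoOut G) {m : ℕ} (hm : m ≠ 1) :
    HasQuadTwoOut (SimpleGraph.cycleGraph (m + 3) ⊕g G) := by
  obtain ⟨l, A, B, h, hq⟩ := h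
  obtain ⟨A', B', hP, h'⟩ := h.cycle hm
  refine ⟨_, _, _, h', hq.glue h.lt h.pos h.lt_out
    (Or.inl ⟨⟨0, by omega⟩, rfl⟩) (Or.inl ⟨⟨1, by omega⟩, rfl⟩)
    (fun w => gibonacci.eq_or_add_le h.pos h.lt_out w) ?_⟩
  have := gibonacci.add_le h.pos h.lt_out (show 2 ≤ m + 2 by omega)
  have := h.lt_out
  have := gibonacci.add_le h.pos h.lt_out (show 2 ≤ m + 3 by omega)
  rw [hP]
  simp only [Finset.mem_insert, Finset.mem_singleton]
  omega

/-- The bound `m` stands for the smallest isolate: `A` with one isolate, `B` with two. The corners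
`p`, `p + s`, `p + t` are not the largest label, so they are at most `m`; this keeps the labels of
the new cycle below all isolates. -/
theorem HasQuad.add_cycleGraph_four {l : V → ℕ} {P : Finset ℕ} (h : SumLabellingWith G l P)
    (hq : HasQuad (labelSet l P)) {m : ℕ} (hlm : ∀ v, l v < m)
    (hm : ∀ n ∈ labelSet l P, ∀ n' ∈ labelSet l P, n < n' → n ≤ m) :
    ∃ l', SumLabellingWith (SimpleGraph.cycleGraph 4 ⊕g G) l' (P.image (10 * ·)) ∧
      (∀ v, l' v < 10 * m) ∧ HasQuad (labelSet l' (P.image (10 * ·))) := by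
  obtain ⟨p, s, t, hp, hs, ht, h1, h2, h3, h4, h5, h6⟩ := hq
  refine ⟨_, h.add_cycleGraph_four hp hs ht h1 h2 h3 h4 h5 h6, ?_, ?_⟩
  · have := hm _ h1 _ h2 (by omega)
    have := hm _ h2 _ h4 (by omega)
    have := hm _ h3 _ h4 (by omega)
    rintro (i | v)
    · fin_cases i <;> simp <;> omega
    · have := hlm v
      simp only [Sum.elim_inr]
      omega
  · have key : ∀ k, 10 * k ∈ labelSet (Sum.elim ![1, 10 * p - 1, 10 * t + 1, 10 * (p + s) - 1]
        (fun v => 10 * l v)) (P.image (10 * ·)) ↔ k ∈ labelSet l P := by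
      intro k
      simp only [labelSet, Set.mem_ofPred_eq, Sum.exists, Sum.elim_inl, Sum.elim_inr,
        Finset.mem_image, mul_right_inj' (show 10 ≠ 0 by decide), exists_eq_right]
      refine or_congr_left (or_iff_right ?_)
      rintro ⟨i, hi⟩
      fin_cases i <;> simp at hi <;> omega
    refine ⟨10 * p, 10 * s, 10 * t, by omega, by omega, by omega, ?_⟩
    simp only [← mul_add, key]
    exact ⟨h1, h2, h3, h4, h5, h6⟩

theorem HasQuadOneOut.add_cycleGraph_four (h : HasQuadOneOut G) :
    HasQuadOneOut (SimpleGraph.cycleGraph 4 ⊕g G) := by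
  obtain ⟨l, A, h, hq⟩ := h
  have hmax : ∀ n ∈ labelSet l {A}, n ≤ A := by
    rintro n (⟨v, rfl⟩ | hn)
    · exact (h.lt v).le
    · exact (Finset.mem_singleton.1 hn).le
  obtain ⟨l', h', hlt, hq'⟩ := hq.add_cycleGraph_four h.labelling h.lt
    fun n hn n' hn' _ => hmax n hn
  rw [Finset.image_singleton] at h' hq'
  exact ⟨l', 10 * A, ⟨h', hlt⟩, hq'⟩

theorem HasQuadTwoOut.add_cycleGraph_four (h : HasQuadTwoOut G) :
    HasQuadTwoOut (SimpleGraph.cycleGraph 4 ⊕g G) := by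
  obtain ⟨l, A, B, h, hq⟩ := h
  have hBA := h.lt_out
  have hA := h.ne_out
  have hmax : ∀ n ∈ labelSet l {A, B}, n ≤ B ∨ n = A := by
    rintro n (⟨v, rfl⟩ | hn)
    · exact Or.inl (h.lt v).le
    · simp only [Finset.mem_insert, Finset.mem_singleton] at hn
      omega
  obtain ⟨l', h', hlt, hq'⟩ := hq.add_cycleGraph_four h.labelling h.lt fun n hn n' hn' hnn => by
    have := hmax n hn
    have := hmax n' hn'
    omega
  rw [Finset.image_insert, Finset.image_singleton] at h' hq'
  exact ⟨l', 10 * A, 10 * B, ⟨h', hlt, by omega, by omega⟩, hq'⟩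

/-! ### Base cases that already contain a parallelogram. -/

/-- The seed for the lowest component. The values 3 and 1 make its labels run 3, 1, 4, 5, …, where
1, 3, 5 is a degenerate parallelogram with both sides 2, and 2 never occurs. -/
theorem twoOutLabelling_of_isEmpty [IsEmpty V] (l : V → ℕ) : TwoOutLabelling G l 3 1 where
  labelling :=
    { inj := fun x => isEmptyElim x
      pos := fun x => isEmptyElim x
      pos_out := by decide
      disj := fun x => isEmptyElim x
      adj_iff := fun x => isEmptyElim x
      out := fun x => isEmptyElim x
      out_out := fun p hp q hq hpq => ⟨fun x => isEmptyElim x, by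
        simp only [Finset.mem_insert, Finset.mem_singleton] at hp hq ⊢
        omega⟩ }
  lt := fun x => isEmptyElim x
  lt_out := by decide
  ne_out := by decide

/-- In the Fibonacci sequence `3, 1, 4, 5, …` the terms `1`, `3`, `5` form a quad. -/
theorem hasQuad_of_three_one {L : Set ℕ} (h0 : 3 ∈ L) (h1 : 1 ∈ L) (h3 : 5 ∈ L) (h2 : 2 ∉ L) :
    HasQuad L :=
  ⟨1, 2, 2, by decide, by decide, by decide, h1, h0, h0, h3, h2, h2⟩

theorem hasQuadOneOut_pathGraph [IsEmpty V] (n : ℕ) :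
    HasQuadOneOut (SimpleGraph.pathGraph (n + 3) ⊕g G) := by
  have h := twoOutLabelling_of_isEmpty (G := G) isEmptyElim
  refine ⟨_, _, h.path (n := n + 3) (by omega), hasQuad_of_three_one
    (Or.inl ⟨Sum.inl 0, rfl⟩) (Or.inl ⟨Sum.inl 1, rfl⟩) ?_ ?_⟩
  -- The corner 5 is the term of index 3: the isolate of a path on three vertices, a vertex label of
  -- any longer path.
  · rcases Nat.eq_zero_or_pos n with rfl | hn
    · exact Or.inr (by simp [gibonacci])
    · exact Or.inl ⟨Sum.inl ⟨3, by omega⟩, rfl⟩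
  · have key : ∀ i, gibonacci 3 1 i ≠ 2 := fun i => by
      have := gibonacci.eq_or_add_le (A := 3) (B := 1) (by decide) (by decide) i
      omega
    rintro (⟨i | i, hi⟩ | hi)
    · exact key i hi
    · exact isEmptyElim i
    · exact key _ (Finset.mem_singleton.1 hi).symm

theorem hasQuadTwoOut_cycleGraph [IsEmpty V] {m : ℕ} (hm : m ≠ 1) :
    HasQuadTwoOut (SimpleGraph.cycleGraph (m + 3) ⊕g G) := by
  have h := twoOutLabelling_of_isEmpty (G := G) isEmptyElim
  obtain ⟨A', B', hP, h'⟩ := h.cycle hm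
  refine ⟨_, _, _, h', hasQuad_of_three_one
    (Or.inl ⟨Sum.inl 0, rfl⟩) (Or.inl ⟨Sum.inl 1, rfl⟩) ?_ ?_⟩
  · rw [hP]
    rcases Nat.eq_zero_or_pos m with rfl | hn
    · exact Or.inr (by simp [gibonacci])
    · exact Or.inl ⟨Sum.inl ⟨3, by omega⟩, rfl⟩
  · have key : ∀ i, gibonacci 3 1 i ≠ 2 := fun i => by
      have := gibonacci.eq_or_add_le (A := 3) (B := 1) (by decide) (by decide) i
      omega
    rw [hP]
    rintro (⟨i | i, hi⟩ | hi)
    · exact key i hi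
    · exact isEmptyElim i
    · simp only [Finset.mem_insert, Finset.mem_singleton] at hi
      rcases hi with hi | hi
      · exact key _ hi.symm
      · omega

end

/-- Since `P₂` with one isolate has no parallelogram, 5 is added as a second isolate. Stacking
another `P₂` labelled 7, 5 leaves the single isolate 12, and 3, 4, 5 is a parallelogram with both
sides 1. -/
theorem twoOutLabelling_pathGraph_two : TwoOutLabelling (SimpleGraph.pathGraph 2) ![3, 4] 7 5 where
  labelling :=
    { inj := by decide
      pos := by decide
      pos_out := by decide
      disj := by decide
      adj_iff := by
        simp only [SimpleGraph.pathGraph_adj]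
        decide
      out := by decide
      out_out := by decide }
  lt := by decide
  lt_out := by decide
  ne_out := by decide

theorem hasQuadOneOut_two_pathGraph_two :
    HasQuadOneOut (SimpleGraph.pathGraph 2 ⊕g SimpleGraph.pathGraph 2) :=
  ⟨_, _, twoOutLabelling_pathGraph_two.path le_rfl, 3, 1, 1, by decide, by decide, by decide,
    by unfold labelSet; decide, by unfold labelSet; decide, by unfold labelSet; decide,
    by unfold labelSet; decide, by unfold labelSet; decide, by unfold labelSet; decide⟩

/-- The edge sums of the second cycle are the labels 16, 7, 3, 12 of the first; those of the first
are 28, 19, 10, 19. The parallelogram is 10, 19, 28, with both sides 9. -/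
theorem hasQuadTwoOut_two_cycleGraph_four :
    HasQuadTwoOut (SimpleGraph.cycleGraph 4 ⊕g SimpleGraph.cycleGraph 4) := by
  have hadj : ∀ x y, (SimpleGraph.cycleGraph 4 ⊕g SimpleGraph.cycleGraph 4).Adj x y ↔
      x ≠ y ∧ ((∃ z, Sum.elim ![16, 12, 7, 3] ![10, 6, 1, 2] z =
        Sum.elim ![16, 12, 7, 3] ![10, 6, 1, 2] x + Sum.elim ![16, 12, 7, 3] ![10, 6, 1, 2] y) ∨
        Sum.elim ![16, 12, 7, 3] ![10, 6, 1, 2] x + Sum.elim ![16, 12, 7, 3] ![10, 6, 1, 2] y ∈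
          ({28, 19} : Finset ℕ)) := by
    rintro (x | x) (y | y)
    · rw [SimpleGraph.sum_adj_inl]
      revert x y
      decide
    · simp only [SimpleGraph.sum_adj]
      revert x y
      decide
    · simp only [SimpleGraph.sum_adj]
      revert x y
      decide
    · rw [SimpleGraph.sum_adj_inr]
      revert x y
      decide
  refine ⟨Sum.elim ![16, 12, 7, 3] ![10, 6, 1, 2], 28, 19,
    ⟨⟨?_, ?_, ?_, ?_, hadj, ?_, ?_⟩, ?_, ?_, ?_⟩, 10, 9, 9, by decide, by decide, by decide,
    by unfold labelSet; decide, by unfold labelSet; decide, by unfold labelSet; decide,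
    by unfold labelSet; decide, by unfold labelSet; decide, by unfold labelSet; decide⟩
  all_goals decide

/-! ### Unions of paths and cycles, and the induction over components. -/

/-- The connected graphs with more than one vertex and maximum degree at most two: `path n` is the
path on `n + 2` vertices and `cycle n` the cycle on `n + 3` vertices. -/
inductive Component : Type
  | path (n : ℕ)
  | cycle (n : ℕ)

namespace Component

/-- The number of vertices of a component. -/
def size : Component → ℕ
  | path n => n + 2
  | cycle n => n + 3

/-- The graph described by a component. -/
def graph : (c : Component) → SimpleGraph (Fin c.size)
  | path n => SimpleGraph.pathGraph (n + 2)
  | cycle n => SimpleGraph.cycleGraph (n + 3)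

/-- The vertices of a disjoint union of components. -/
def unionVerts : List Component → Type
  | [] => Empty
  | c :: L => Fin c.size ⊕ unionVerts L

/-- The disjoint union of a list of components. -/
def union : (L : List Component) → SimpleGraph (unionVerts L)
  | [] => (⊥ : SimpleGraph Empty)
  | c :: L => c.graph ⊕g union L

instance : IsEmpty (unionVerts []) := inferInstanceAs (IsEmpty Empty)

theorem nonempty_union_iso_of_perm {L L' : List Component} (h : L.Perm L') :
    Nonempty (union L ≃g union L') := by
  induction h with
  | nil => exact ⟨SimpleGraph.Iso.refl⟩
  | cons c _ ih =>
    obtain ⟨e⟩ := ih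
    exact ⟨SimpleGraph.Iso.sumCongr SimpleGraph.Iso.refl e⟩
  | swap c d L =>
    exact ⟨SimpleGraph.Iso.sumAssoc.symm.trans
      ((SimpleGraph.Iso.sumCongr SimpleGraph.Iso.sumComm SimpleGraph.Iso.refl).trans
        SimpleGraph.Iso.sumAssoc)⟩
  | trans _ _ ih1 ih2 =>
    obtain ⟨e1⟩ := ih1
    obtain ⟨e2⟩ := ih2
    exact ⟨e1.trans e2⟩

/-- Adding an empty graph changes nothing. -/
def sumEmptyIso {V W : Type*} (G : SimpleGraph V) (H : SimpleGraph W) [IsEmpty W] : G ⊕g H ≃g G where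
  toEquiv := Equiv.sumEmpty V W
  map_rel_iff' := by
    rintro (a | a) (b | b)
    · simp
    · exact isEmptyElim b
    · exact isEmptyElim a
    · exact isEmptyElim a

/-- The iso between a one-element union and its component. -/
def unionSingletonIso (c : Component) : union [c] ≃g c.graph := sumEmptyIso _ (union [])

/-- The iso between a two-element union and the sum of its components. -/
def unionPairIso (c d : Component) : union [c, d] ≃g c.graph ⊕g d.graph :=
  SimpleGraph.Iso.sumCongr SimpleGraph.Iso.refl (unionSingletonIso d)

/-- The labellings with quads that a disjoint union of components is expected to have. -/
def HasGoodLabelling (L : List Component) : Prop :=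
  ((∃ n, path n ∈ L) → HasQuadOneOut (union L)) ∧ ((∀ n, path n ∉ L) → HasQuadTwoOut (union L))

theorem HasGoodLabelling.twoOut {L : List Component} (h : HasGoodLabelling L) :
    HasQuadTwoOut (union L) := by
  by_cases hL : ∃ n, path n ∈ L
  · exact (h.1 hL).twoOut
  · exact h.2 (not_exists.1 hL)

theorem HasGoodLabelling.of_perm {L L' : List Component} (h : HasGoodLabelling L)
    (hL : L'.Perm L) : HasGoodLabelling L' := by
  obtain ⟨e⟩ := nonempty_union_iso_of_perm hL
  simp only [HasGoodLabelling, hL.mem_iff]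
  exact ⟨fun hp => (h.1 hp).of_iso e, fun hp => (h.2 hp).of_iso e⟩

theorem hasGoodLabelling_path_cons {L : List Component} {n : ℕ}
    (h : HasQuadOneOut (union (path n :: L))) : HasGoodLabelling (path n :: L) :=
  ⟨fun _ => h, fun hp => (hp n List.mem_cons_self).elim⟩

theorem HasGoodLabelling.cycle_one_cons {L : List Component} (h : HasGoodLabelling L) :
    HasGoodLabelling (cycle 1 :: L) := by
  simp only [HasGoodLabelling, List.mem_cons, reduceCtorEq, false_or]
  exact ⟨fun hp => (h.1 hp).add_cycleGraph_four, fun hp => (h.2 hp).add_cycleGraph_four⟩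

theorem HasGoodLabelling.path_cons {L : List Component} (h : HasGoodLabelling L) (n : ℕ) :
    HasGoodLabelling (path n :: L) :=
  hasGoodLabelling_path_cons (h.twoOut.path (by omega))

theorem hasGoodLabelling_path (n : ℕ) : HasGoodLabelling [path (n + 1)] :=
  hasGoodLabelling_path_cons (hasQuadOneOut_pathGraph n)

theorem hasGoodLabelling_cycle {m : ℕ} (hm : m ≠ 1) : HasGoodLabelling [cycle m] :=
  ⟨fun ⟨n, hn⟩ => by simp at hn, fun _ => hasQuadTwoOut_cycleGraph hm⟩

theorem hasGoodLabelling_two_path_zero : HasGoodLabelling [path 0, path 0] :=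
  hasGoodLabelling_path_cons (hasQuadOneOut_two_pathGraph_two.of_iso (unionPairIso _ _))

theorem hasGoodLabelling_two_cycle_one : HasGoodLabelling [cycle 1, cycle 1] :=
  ⟨fun ⟨n, hn⟩ => by simp at hn,
    fun _ => hasQuadTwoOut_two_cycleGraph_four.of_iso (unionPairIso _ _)⟩

/-- The induction peels components from the top: four-cycles before all others because they cost no
isolate, then paths because a path reduces two isolates to one, and the other cycles last. The work
lies in avoiding the excluded lists as remainders. -/
theorem hasGoodLabelling (L : List Component) (h0 : L ≠ []) (h1 : L ≠ [path 0])
    (h2 : L ≠ [cycle 1]) (h3 : ¬ L.Perm [cycle 1, path 0]) : HasGoodLabelling L := by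
  induction hk : L.length using Nat.strong_induction_on generalizing L with
  | _ k ih =>
  subst hk
  replace ih : ∀ c L', L.Perm (c :: L') → L' ≠ [] → L' ≠ [path 0] → L' ≠ [cycle 1] →
      ¬ L'.Perm [cycle 1, path 0] → HasGoodLabelling L' := fun c L' hL h0 h1 h2 h3 =>
    ih L'.length (by rw [hL.length_eq]; simp) L' h0 h1 h2 h3 rfl
  have extract : ∀ c ∈ L, ∃ L', L.Perm (c :: L') := fun c hc => by
    obtain ⟨s, t, rfl⟩ := List.append_of_mem hc
    exact ⟨s ++ t, List.perm_middle⟩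
  by_cases hC : cycle 1 ∈ L
  · obtain ⟨L', hL⟩ := extract _ hC
    refine HasGoodLabelling.of_perm ?_ hL
    by_cases h0' : L' = []
    · subst h0'
      exact (h2 (List.perm_singleton.1 hL)).elim
    by_cases h1' : L' = [path 0]
    · subst h1'
      exact (h3 hL).elim
    by_cases h2' : L' = [cycle 1]
    · subst h2'
      exact hasGoodLabelling_two_cycle_one
    by_cases h3' : L'.Perm [cycle 1, path 0]
    -- For `2C₄ + P₂` removing a four-cycle would leave an excluded list, so the path is put on top
    -- of the two four-cycles instead.
    · exact (hasGoodLabelling_two_cycle_one.path_cons 0).of_perm <|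
        ((h3'.trans (List.Perm.swap _ _ _)).cons _).trans (List.Perm.swap _ _ _)
    exact (ih _ L' hL h0' h1' h2' h3').cycle_one_cons
  have hC' : ∀ c L', L.Perm (c :: L') → cycle 1 ∉ L' := fun c L' hL hc =>
    hC (hL.mem_iff.2 (List.mem_cons_of_mem _ hc))
  by_cases hP : ∃ n, path n ∈ L
  · obtain ⟨n, hn⟩ := hP
    obtain ⟨L', hL⟩ := extract _ hn
    have hCL := hC' _ _ hL
    refine HasGoodLabelling.of_perm ?_ hL
    by_cases h0' : L' = []
    · subst h0'
      match n with
      | 0 => exact (h1 (List.perm_singleton.1 hL)).elim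
      | n + 1 => exact hasGoodLabelling_path n
    by_cases h1' : L' = [path 0]
    · subst h1'
      match n with
      | 0 => exact hasGoodLabelling_two_path_zero
      -- The longer path has a parallelogram while `P₂` has none, so the longer path goes below.
      | n + 1 => exact ((hasGoodLabelling_path n).path_cons 0).of_perm (List.Perm.swap _ _ _)
    refine (ih _ L' hL h0' h1' ?_ ?_).path_cons n
    · rintro rfl
      simp at hCL
    · intro h
      simp [h.mem_iff] at hCL
  · match L, h0 with
    | path n :: L', _ => exact (hP ⟨n, List.mem_cons_self⟩).elim
    | cycle m :: L', _ =>
      have hm : m ≠ 1 := by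
        rintro rfl
        exact hC List.mem_cons_self
      have hCL := hC' _ _ (List.Perm.refl _)
      have hPL : ∀ n, path n ∉ L' := fun n hn => hP ⟨n, List.mem_cons_of_mem _ hn⟩
      by_cases h0' : L' = []
      · subst h0'
        exact hasGoodLabelling_cycle hm
      have hL' : HasGoodLabelling L' := by
        refine ih _ L' (List.Perm.refl _) h0' ?_ ?_ ?_
        · rintro rfl
          simp at hPL
        · rintro rfl
          simp at hCL
        · intro h
          simp [h.mem_iff] at hCL
      exact ⟨fun hp => (hP hp).elim, fun _ => hL'.twoOut.cycle hm⟩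

theorem exists_unique_adj_of_path_mem {L : List Component} {n : ℕ} (h : path n ∈ L) :
    ∃ x y, (union L).Adj x y ∧ ∀ z, (union L).Adj x z → z = y := by
  obtain ⟨s, t, rfl⟩ := List.append_of_mem h
  obtain ⟨e⟩ := nonempty_union_iso_of_perm (List.perm_middle (a := path n) (l₁ := s) (l₂ := t))
  have hend : ∃ x y, (path n).graph.Adj x y ∧ ∀ z, (path n).graph.Adj x z → z = y := by
    change ∃ x y, (SimpleGraph.pathGraph (n + 2)).Adj x y ∧
      ∀ z, (SimpleGraph.pathGraph (n + 2)).Adj x z → z = y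
    simp only [SimpleGraph.pathGraph_adj]
    refine ⟨0, 1, Or.inl rfl, fun z hz => Fin.ext ?_⟩
    simp at hz ⊢
    omega
  obtain ⟨x, y, hxy, huniq⟩ := hend
  refine ⟨e.symm (Sum.inl x), e.symm (Sum.inl y), e.symm.map_adj_iff.2 hxy, fun z hz => ?_⟩
  obtain ⟨z, rfl⟩ := e.symm.surjective z
  replace hz := e.symm.map_adj_iff.1 hz
  rcases z with z | z
  · exact congrArg (fun w => e.symm (Sum.inl w)) (huniq z hz)
  · simp [union] at hz

theorem exists_two_adj_cycleGraph {m : ℕ} (x : Fin (m + 3)) :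
    ∃ y z, y ≠ z ∧ (SimpleGraph.cycleGraph (m + 3)).Adj x y ∧
      (SimpleGraph.cycleGraph (m + 3)).Adj x z := by
  have hmem : ∀ y, (SimpleGraph.cycleGraph (m + 3)).Adj x y ↔ y = x - 1 ∨ y = x + 1 :=
    Set.ext_iff.1 (SimpleGraph.cycleGraph_neighborSet (n := m + 1) (v := x))
  refine ⟨x - 1, x + 1, fun he => ?_, (hmem _).2 (Or.inl rfl), (hmem _).2 (Or.inr rfl)⟩
  -- If `x - 1 = x + 1`, the neighbourhood would be a singleton, against degree 2.
  have := SimpleGraph.cycleGraph_degree_three_le (v := x)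
  rw [SimpleGraph.cycleGraph_degree_two_le, he] at this
  simp at this

theorem exists_two_adj {L : List Component} (h : ∀ n, path n ∉ L) (x : unionVerts L) :
    ∃ y z, y ≠ z ∧ (union L).Adj x y ∧ (union L).Adj x z := by
  induction L with
  | nil => exact isEmptyElim x
  | cons c L ih =>
    rcases x with x | x
    · match c, x, h with
      | path n, _, h => exact (h n List.mem_cons_self).elim
      | cycle m, x, _ =>
        obtain ⟨y, z, hyz, hy, hz⟩ := exists_two_adj_cycleGraph x
        exact ⟨Sum.inl y, Sum.inl z, fun he => hyz (Sum.inl_injective he), hy, hz⟩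
    · obtain ⟨y, z, hyz, hy, hz⟩ := ih (fun n hn => h n (List.mem_cons_of_mem _ hn)) x
      exact ⟨Sum.inr y, Sum.inr z, fun he => hyz (Sum.inr_injective he), hy, hz⟩

end Component

/-! ### Decomposition into paths and cycles by means of a longest path. -/

namespace SimpleGraph

variable {V : Type*} {G : SimpleGraph V}

/-- A connected component described by an induced embedding whose range is closed under adjacency
can be split off. -/
theorem nonempty_iso_sum_of_closed {n : ℕ} {H : SimpleGraph (Fin n)} (e : H ↪g G)
    (h : ∀ i w, G.Adj (e i) w → w ∈ Set.range e) :
    Nonempty (G ≃g H ⊕g G.induce (Set.range e)ᶜ) := by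
  classical
  let f : Fin n ⊕ ((Set.range e)ᶜ : Set V) ≃ V :=
    (Equiv.sumCongr (Equiv.ofInjective e e.injective) (Equiv.refl _)).trans
      (Equiv.Set.sumCompl (Set.range e))
  have f1 : ∀ i, f (Sum.inl i) = e i := fun i => by
    simp [f, Equiv.Set.sumCompl_apply_inl]
  have f2 : ∀ x, f (Sum.inr x) = x := fun x => by
    simp [f, Equiv.Set.sumCompl_apply_inr]
  refine ⟨RelIso.symm ⟨f, ?_⟩⟩
  rintro (i | x) (j | y)
  · rw [f1, f1, sum_adj_inl]
    exact e.map_adj_iff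
  · rw [f1, f2]
    simp only [sum_adj, iff_false]
    exact fun hadj => y.2 (h i y hadj)
  · rw [f1, f2]
    simp only [sum_adj, iff_false]
    exact fun hadj => x.2 (h j x hadj.symm)
  · rw [f2, f2, sum_adj_inr]
    rfl

/-- A sequence of `m` distinct vertices, consecutive ones being adjacent. -/
def IsVertexPath (G : SimpleGraph V) (m : ℕ) (v : ℕ → V) : Prop :=
  Set.InjOn v (Set.Iio m) ∧ ∀ i, i + 1 < m → G.Adj (v i) (v (i + 1))

theorem IsVertexPath.reverse {m : ℕ} {v : ℕ → V} (h : G.IsVertexPath m v) :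
    G.IsVertexPath m fun i => v (m - 1 - i) := by
  constructor
  · intro i hi j hj hij
    simp only [Set.mem_Iio] at hi hj
    have := h.1 (show m - 1 - i ∈ Set.Iio m by simp; omega)
      (show m - 1 - j ∈ Set.Iio m by simp; omega) hij
    omega
  · intro i hi
    have := h.2 (m - 1 - (i + 1)) (by omega)
    rw [show m - 1 - (i + 1) + 1 = m - 1 - i by omega] at this
    exact this.symm

theorem exists_maximal_isVertexPath [Finite V] [Nonempty V] (G : SimpleGraph V) :
    ∃ m v, 0 < m ∧ G.IsVertexPath m v ∧ ∀ m' v', G.IsVertexPath m' v' → m' ≤ m := by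
  classical
  have := Fintype.ofFinite V
  have hbound : ∀ m v, G.IsVertexPath m v → m ≤ Fintype.card V := by
    intro m v h
    have := Fintype.card_le_of_injective (fun i : Fin m => v i)
      fun i j hij => Fin.ext (h.1 i.2 j.2 hij)
    simpa using this
  obtain ⟨x⟩ := ‹Nonempty V›
  have h1 : ∃ v, G.IsVertexPath 1 v :=
    ⟨fun _ => x, fun i hi j hj _ => by simp at hi hj; omega, fun i hi => by omega⟩
  have hcard : 1 ≤ Fintype.card V := hbound 1 _ h1.choose_spec
  obtain ⟨v, hv⟩ := Nat.findGreatest_spec (P := fun m => ∃ v, G.IsVertexPath m v) hcard h1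
  refine ⟨_, v, ?_, hv, fun m' v' h' => Nat.le_findGreatest (hbound _ _ h') ⟨v', h'⟩⟩
  exact Nat.le_findGreatest hcard h1

/-- All neighbours of the last vertex of a longest path lie on the path. -/
theorem IsVertexPath.exists_eq_of_adj_last {m : ℕ} {v : ℕ → V} (h : G.IsVertexPath m v)
    (hm : 0 < m) (hmax : ∀ m' v', G.IsVertexPath m' v' → m' ≤ m) {w : V}
    (hw : G.Adj (v (m - 1)) w) : ∃ i < m, v i = w := by
  by_contra hne
  push Not at hne
  have : G.IsVertexPath (m + 1) (Function.update v m w) := by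
    constructor
    · intro i hi j hj hij
      simp only [Set.mem_Iio] at hi hj
      rcases (Nat.lt_succ_iff_lt_or_eq.1 hi) with hi | rfl <;>
        rcases (Nat.lt_succ_iff_lt_or_eq.1 hj) with hj | rfl
      · rw [Function.update_of_ne hi.ne, Function.update_of_ne hj.ne] at hij
        exact h.1 hi hj hij
      · rw [Function.update_of_ne hi.ne, Function.update_self] at hij
        exact (hne i hi hij).elim
      · rw [Function.update_of_ne hj.ne, Function.update_self] at hij
        exact (hne j hj hij.symm).elim
      · rfl
    · intro i hi
      rw [Function.update_of_ne (by omega)]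
      rcases eq_or_ne (i + 1) m with rfl | hi'
      · rw [Function.update_self]
        exact hw
      · rw [Function.update_of_ne hi']
        exact h.2 i (by omega)
  have := hmax _ _ this
  omega

/-- In a graph of maximum degree at most two without isolated vertices a path or a cycle can be
split off. -/
theorem exists_component_iso [Finite V] [Nonempty V]
    (hdeg : ∀ x a b c, G.Adj x a → G.Adj x b → G.Adj x c → a = b ∨ a = c ∨ b = c)
    (hiso : ∀ x, ∃ y, G.Adj x y) :
    ∃ (c : Component) (s : Set V), s ≠ Set.univ ∧
      (∀ x ∈ s, ∀ y, G.Adj x y → y ∈ s) ∧ Nonempty (G ≃g c.graph ⊕g G.induce s) := by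
  obtain ⟨m, v, hm0, hv, hmax⟩ := exists_maximal_isVertexPath G
  have hinj : ∀ i j, i < m → j < m → v i = v j → i = j := fun i j hi hj => hv.1 hi hj
  have hlast : ∀ w, G.Adj (v (m - 1)) w → ∃ i < m, v i = w := fun w =>
    hv.exists_eq_of_adj_last hm0 hmax
  have hfirst : ∀ w, G.Adj (v 0) w → ∃ i < m, v i = w := by
    intro w hw
    obtain ⟨i, hi, hi'⟩ := hv.reverse.exists_eq_of_adj_last hm0 hmax (w := w) (by simpa using hw)
    exact ⟨m - 1 - i, by omega, hi'⟩
  have hm2 : 2 ≤ m := by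
    obtain ⟨w, hw⟩ := hiso (v (m - 1))
    obtain ⟨i, hi, rfl⟩ := hlast w hw
    by_contra hm
    obtain rfl : i = m - 1 := by omega
    exact hw.ne rfl
  have hinner : ∀ i w, 0 < i → i + 1 < m → G.Adj (v i) w → w = v (i - 1) ∨ w = v (i + 1) := by
    intro i w hi0 hi hw
    have h1 := (hv.2 (i - 1) (by omega)).symm
    rw [Nat.sub_add_cancel hi0] at h1
    rcases hdeg _ _ _ _ hw h1 (hv.2 i hi) with h | h | h
    · exact Or.inl h
    · exact Or.inr h
    · have := hinj _ _ (by omega) (by omega) h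
      omega
  have hclosed : ∀ i < m, ∀ w, G.Adj (v i) w → ∃ j < m, v j = w := by
    intro i hi w hw
    rcases Nat.eq_zero_or_pos i with rfl | hi0
    · exact hfirst w hw
    · rcases Nat.lt_or_ge (i + 1) m with hi1 | hi1
      · rcases hinner i w hi0 hi1 hw with rfl | rfl
        · exact ⟨i - 1, by omega, rfl⟩
        · exact ⟨i + 1, hi1, rfl⟩
      · obtain rfl : i = m - 1 := by omega
        exact hlast w hw
  -- An inner vertex already has its two neighbours next to it on the path, so the only possible
  -- chord joins the two ends.
  have hadj : ∀ i j, i < j → j < m →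
      (G.Adj (v i) (v j) → i + 1 = j ∨ (i = 0 ∧ j = m - 1)) := by
    intro i j hij hj hadj
    rcases Nat.eq_zero_or_pos i with rfl | hi0
    · rcases Nat.lt_or_ge (j + 1) m with hj1 | hj1
      · rcases hinner j _ (by omega) hj1 hadj.symm with h | h <;>
          have := hinj _ _ (by omega) (by omega) h <;> omega
      · omega
    · rcases hinner i _ hi0 (by omega) hadj with h | h <;>
        have := hinj _ _ (by omega) (by omega) h <;> omega
  have finish : ∀ (c : Component), c.size = m →
      (∀ i j : Fin c.size, i < j → (G.Adj (v i) (v j) ↔ c.graph.Adj i j)) →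
      ∃ (c : Component) (s : Set V), s ≠ Set.univ ∧
        (∀ x ∈ s, ∀ y, G.Adj x y → y ∈ s) ∧ Nonempty (G ≃g c.graph ⊕g G.induce s) := by
    rintro c rfl hc
    let e : c.graph ↪g G :=
      { toFun := fun i => v i
        inj' := fun i j hij => Fin.ext (hinj _ _ i.2 j.2 hij)
        map_rel_iff' := by
          intro i j
          change G.Adj (v i) (v j) ↔ _
          rcases lt_trichotomy i j with hij | rfl | hij
          · exact hc i j hij
          · simp
          · rw [G.adj_comm, c.graph.adj_comm]
            exact hc j i hij }
    have he : ∀ i w, G.Adj (e i) w → w ∈ Set.range e := by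
      intro i w hw
      obtain ⟨j, hj, rfl⟩ := hclosed i i.2 w hw
      exact ⟨⟨j, hj⟩, rfl⟩
    refine ⟨c, (Set.range e)ᶜ, ?_, ?_, nonempty_iso_sum_of_closed e he⟩
    · intro hu
      have : e ⟨0, hm0⟩ ∈ (Set.range e)ᶜ := hu ▸ Set.mem_univ _
      exact this ⟨_, rfl⟩
    · rintro x hx y hy ⟨i, rfl⟩
      exact hx (he i x hy.symm)
  -- The two ends of a path on two vertices are adjacent without forming a cycle, hence the
  -- condition `3 ≤ m`.
  by_cases hcyc : G.Adj (v 0) (v (m - 1)) ∧ 3 ≤ m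
  · obtain ⟨hcyc, hm3⟩ := hcyc
    obtain ⟨n, rfl⟩ := Nat.exists_eq_add_of_le' hm3
    refine finish (.cycle n) rfl fun i j hij => ?_
    change Fin (n + 3) at i j
    change _ ↔ (cycleGraph (n + 3)).Adj i j
    rw [cycleGraph_add_three_adj hij]
    refine ⟨hadj i j hij j.2, ?_⟩
    rintro (h | ⟨h1, h2⟩)
    · rw [← h]
      exact hv.2 i (lt_of_eq_of_lt h j.2)
    · rw [h1, h2]
      exact hcyc
  · obtain ⟨n, rfl⟩ := Nat.exists_eq_add_of_le' hm2
    refine finish (.path n) rfl fun i j hij => ?_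
    change Fin (n + 2) at i j
    change _ ↔ (pathGraph (n + 2)).Adj i j
    rw [pathGraph_adj]
    have hij' : (i : ℕ) < j := hij
    constructor
    · intro h
      rcases hadj i j hij j.2 h with h' | ⟨h1, h2⟩
      · exact Or.inl h'
      · rw [h1, h2] at h
        have : ¬ 3 ≤ n + 2 := fun hn => hcyc ⟨h, hn⟩
        omega
    · rintro (h | h)
      · rw [← h]
        exact hv.2 i (lt_of_eq_of_lt h j.2)
      · omega

/-- A finite graph of maximum degree at most two without isolated vertices is a disjoint union of
paths and cycles. -/
theorem exists_iso_union [Finite V]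
    (hdeg : ∀ x a b c, G.Adj x a → G.Adj x b → G.Adj x c → a = b ∨ a = c ∨ b = c)
    (hiso : ∀ x, ∃ y, G.Adj x y) : ∃ L, Nonempty (G ≃g Component.union L) := by
  induction hk : Nat.card V using Nat.strong_induction_on generalizing V with
  | _ k ih =>
  subst hk
  rcases isEmpty_or_nonempty V with hV | hV
  · exact ⟨[], ⟨⟨Equiv.equivOfIsEmpty V (Component.unionVerts []), fun {a} => isEmptyElim a⟩⟩⟩
  · obtain ⟨c, s, hs, hclosed, ⟨e⟩⟩ := exists_component_iso hdeg hiso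
    have hcard : Nat.card s < Nat.card V := Set.ncard_lt_card hs
    obtain ⟨L, ⟨f⟩⟩ := ih _ hcard (G := G.induce s)
      (fun x a b c ha hb hc => by
        simp only [Subtype.ext_iff]
        exact hdeg _ _ _ _ ha hb hc)
      (fun x => by
        obtain ⟨y, hy⟩ := hiso x
        exact ⟨⟨y, hclosed x x.2 y hy⟩, hy⟩) rfl
    exact ⟨c :: L, ⟨e.trans (Iso.sumCongr Iso.refl f)⟩⟩

end SimpleGraph

/-! ### Lower bounds for the number of isolates, and the exceptional graphs. -/

namespace SimpleGraph

variable {V W : Type*} {G : SimpleGraph V} {l : V → ℕ}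

theorem IsSumLabelling.comp_iso {V W : Type*} {G : SimpleGraph V} {H : SimpleGraph W} {l : W → ℕ}
    (h : H.IsSumLabelling l) (e : G ≃g H) : G.IsSumLabelling (l ∘ e) := by
  refine ⟨h.1.comp e.injective, fun v => h.2.1 _, fun x y => ?_⟩
  rw [← e.map_adj_iff, h.2.2, ne_eq, e.injective.eq_iff,
    e.surjective.exists (p := fun z => l z = l (e x) + l (e y))]
  rfl

theorem isSumGraph_addIsolates_of_iso {H : SimpleGraph W} (e : G ≃g H) {k : ℕ}
    (h : (H.addIsolates k).IsSumGraph) : (G.addIsolates k).IsSumGraph := by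
  obtain ⟨l, hl⟩ := h
  exact ⟨_, hl.comp_iso (Iso.sumCongr e Iso.refl)⟩

theorem sumNumber_eq {k : ℕ} (h : (G.addIsolates k).IsSumGraph)
    (hmin : ∀ j, (G.addIsolates j).IsSumGraph → k ≤ j) : G.sumNumber = k :=
  le_antisymm (Nat.sInf_le h) (le_csInf ⟨k, h⟩ hmin)

theorem IsSumLabelling.adj (h : G.IsSumLabelling l) {x y z : V} (hxy : x ≠ y)
    (hz : l z = l x + l y) : G.Adj x y :=
  (h.2.2 x y).2 ⟨hxy, z, hz⟩

/-- The neighbours of the largest non-isolated vertex give isolates. -/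
theorem exists_largest_vertex [Finite V] [Nonempty V] {k : ℕ} {l : V ⊕ Fin k → ℕ}
    (h : (G.addIsolates k).IsSumLabelling l) :
    ∃ x, ∀ y, G.Adj x y → ∃ i, l (Sum.inr i) = l (Sum.inl x) + l (Sum.inl y) := by
  obtain ⟨x, hx⟩ := Finite.exists_max fun v => l (Sum.inl v)
  refine ⟨x, fun y hxy => ?_⟩
  obtain ⟨-, z | i, hz⟩ := (h.2.2 (Sum.inl x) (Sum.inl y)).1 (sum_adj_inl.2 hxy)
  · have := hx z
    have := h.2.1 (Sum.inl y)
    omega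
  · exact ⟨i, hz⟩

theorem one_le_of_isSumGraph [Finite V] [Nonempty V] (hG : ∀ x, ∃ y, G.Adj x y) {k : ℕ}
    (h : (G.addIsolates k).IsSumGraph) : 1 ≤ k := by
  obtain ⟨l, h⟩ := h
  obtain ⟨x, hx⟩ := exists_largest_vertex h
  obtain ⟨y, hy⟩ := hG x
  obtain ⟨i, -⟩ := hx y hy
  exact i.pos

theorem two_le_of_isSumGraph [Finite V] [Nonempty V]
    (hG : ∀ x, ∃ y z, y ≠ z ∧ G.Adj x y ∧ G.Adj x z) {k : ℕ}
    (h : (G.addIsolates k).IsSumGraph) : 2 ≤ k := by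
  obtain ⟨l, h⟩ := h
  obtain ⟨x, hx⟩ := exists_largest_vertex h
  obtain ⟨y, z, hyz, hy, hz⟩ := hG x
  obtain ⟨i, hi⟩ := hx y hy
  obtain ⟨j, hj⟩ := hx z hz
  have hij : i ≠ j := by
    rintro rfl
    exact hyz (Sum.inl_injective (h.1 (by omega)))
  have := Fin.val_ne_of_ne hij
  omega

/-- In a sum labelling the sums of adjacent labels of a four-cycle component are labels of vertices
outside of that component. -/
theorem IsSumLabelling.exists_sums_of_ordered (h : G.IsSumLabelling l) {a b c d : V}
    (ha : ∀ w, G.Adj a w ↔ w = b ∨ w = d) (hb : ∀ w, G.Adj b w ↔ w = a ∨ w = c)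
    (hc : ∀ w, G.Adj c w ↔ w = b ∨ w = d) (had : l a < l d) (hbd : l b < l d) (hca : l c < l a) :
    ∃ zab zbc zcd zda, l zab = l a + l b ∧ l zbc = l b + l c ∧ l zcd = l c + l d ∧
      l zda = l d + l a ∧ ∀ z, z = zab ∨ z = zbc ∨ z = zcd ∨ z = zda →
        z ≠ a ∧ z ≠ b ∧ z ≠ c ∧ z ≠ d := by
  obtain ⟨-, zab, hab⟩ := (h.2.2 a b).1 ((ha b).2 (Or.inl rfl))
  obtain ⟨-, zbc, hbc⟩ := (h.2.2 b c).1 ((hb c).2 (Or.inr rfl))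
  obtain ⟨-, zcd, hcd⟩ := (h.2.2 c d).1 ((hc d).2 (Or.inr rfl))
  obtain ⟨-, zda, hda⟩ := (h.2.2 d a).1 ((ha d).2 (Or.inr rfl)).symm
  have pa := h.2.1 a
  have pb := h.2.1 b
  have pc := h.2.1 c
  have pd := h.2.1 d
  have bcb : zbc ≠ b := by rintro rfl; omega
  have bcc : zbc ≠ c := by rintro rfl; omega
  have aba : zab ≠ a := by rintro rfl; omega
  have abb : zab ≠ b := by rintro rfl; omega
  have abc : zab ≠ c := by rintro rfl; omega
  -- If `b + c = a` as labels, then `b + (c + d) = a + d` is a label, so `zcd` would be a neighbour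
  -- of `b`; but its label exceeds that of `d`. The next two steps regroup a sum of three labels in
  -- the same way.
  have bca : zbc ≠ a := by
    rintro rfl
    have hne : b ≠ zcd := by rintro rfl; omega
    rcases (hb zcd).1 (h.adj (z := zda) hne (by omega)) with rfl | rfl <;> omega
  have abd : zab ≠ d := by
    rintro rfl
    rcases (ha zbc).1 (h.adj (z := zcd) bca.symm (by omega)) with rfl | rfl <;> omega
  have bcd : zbc ≠ d := by
    rintro rfl
    rcases (hc zab).1 (h.adj (z := zda) abc.symm (by omega)) with rfl | rfl <;> omega
  refine ⟨zab, zbc, zcd, zda, hab, hbc, hcd, hda, ?_⟩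
  rintro z (rfl | rfl | rfl | rfl)
  · exact ⟨aba, abb, abc, abd⟩
  · exact ⟨bca, bcb, bcc, bcd⟩
  · refine ⟨?_, ?_, ?_, ?_⟩ <;> rintro rfl <;> omega
  · refine ⟨?_, ?_, ?_, ?_⟩ <;> rintro rfl <;> omega

/-- The cycle is rotated so that `d` carries its largest label and reflected so that, of the
neighbours of `d`, `c` has the smaller label. -/
theorem IsSumLabelling.exists_sums (h : G.IsSumLabelling l) {q : Fin 4 → V}
    (hq : Function.Injective q) (hadj : ∀ i w, G.Adj (q i) w ↔ w = q (i + 1) ∨ w = q (i + 3)) :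
    ∃ a b c d, (∃ i, q i = c) ∧ l a < l d ∧ l b < l d ∧ l c < l a ∧
      ∃ zab zbc zcd zda, l zab = l a + l b ∧ l zbc = l b + l c ∧ l zcd = l c + l d ∧
      l zda = l d + l a ∧ (∀ i, l (q i) < l zcd) ∧
      ∀ z, z = zab ∨ z = zbc ∨ z = zcd ∨ z = zda → z ∉ Set.range q := by
  obtain ⟨i, hi⟩ := Finite.exists_max fun i => l (q i)
  have hlt : ∀ j, j ≠ i → l (q j) < l (q i) := fun j hj =>
    (hi j).lt_of_ne fun he => hj (hq (h.1 he))
  have hcover : ∀ j, j = i ∨ j = i + 1 ∨ j = i + 2 ∨ j = i + 3 := by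
    exact (by decide : ∀ i j : Fin 4, j = i ∨ j = i + 1 ∨ j = i + 2 ∨ j = i + 3) i
  have h1 : i + 1 ≠ i := by simp
  have h2 : i + 2 ≠ i := (by decide : ∀ i : Fin 4, i + 2 ≠ i) i
  have h3 : i + 3 ≠ i := (by decide : ∀ i : Fin 4, i + 3 ≠ i) i
  have h13 : l (q (i + 1)) ≠ l (q (i + 3)) := fun he => by
    have := hq (h.1 he)
    simp at this
  have e1 : i + 1 + 1 = i + 2 := (by decide : ∀ i : Fin 4, i + 1 + 1 = i + 2) i
  have e2 : i + 1 + 3 = i := (by decide : ∀ i : Fin 4, i + 1 + 3 = i) i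
  have e3 : i + 2 + 1 = i + 3 := (by decide : ∀ i : Fin 4, i + 2 + 1 = i + 3) i
  have e4 : i + 2 + 3 = i + 1 := (by decide : ∀ i : Fin 4, i + 2 + 3 = i + 1) i
  have e5 : i + 3 + 1 = i := (by decide : ∀ i : Fin 4, i + 3 + 1 = i) i
  have e6 : i + 3 + 3 = i + 2 := (by decide : ∀ i : Fin 4, i + 3 + 3 = i + 2) i
  have n1 := hadj (i + 1)
  have n2 := hadj (i + 2)
  have n3 := hadj (i + 3)
  rw [e1, e2] at n1
  rw [e3, e4] at n2
  rw [e5, e6] at n3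
  have hout : ∀ z, z ≠ q i → z ≠ q (i + 1) → z ≠ q (i + 2) → z ≠ q (i + 3) →
      z ∉ Set.range q := by
    rintro _ hz hz1 hz2 hz3 ⟨j, rfl⟩
    rcases hcover j with rfl | rfl | rfl | rfl
    · exact hz rfl
    · exact hz1 rfl
    · exact hz2 rfl
    · exact hz3 rfl
  rcases lt_or_gt_of_ne h13 with hlt13 | hlt13
  · obtain ⟨zab, zbc, zcd, zda, hab, hbc, hcd, hda, hz⟩ :=
      h.exists_sums_of_ordered (a := q (i + 3)) (b := q (i + 2)) (c := q (i + 1)) (d := q i)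
        (fun w => (n3 w).trans or_comm) n2 n1 (hlt _ h3) (hlt _ h2) hlt13
    refine ⟨_, _, _, _, ⟨_, rfl⟩, hlt _ h3, hlt _ h2, hlt13, zab, zbc, zcd, zda, hab, hbc, hcd,
      hda, ?_, fun z hz' => ?_⟩
    · intro j
      have : l (q j) ≤ l (q i) := hi j
      have := h.2.1 (q (i + 1))
      omega
    · obtain ⟨h1, h2, h3, h4⟩ := hz z hz'
      exact hout z h4 h3 h2 h1
  · obtain ⟨zab, zbc, zcd, zda, hab, hbc, hcd, hda, hz⟩ :=
      h.exists_sums_of_ordered (a := q (i + 1)) (b := q (i + 2)) (c := q (i + 3)) (d := q i)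
        n1 (fun w => (n2 w).trans or_comm) (fun w => (n3 w).trans or_comm)
        (hlt _ h1) (hlt _ h2) hlt13
    refine ⟨_, _, _, _, ⟨_, rfl⟩, hlt _ h1, hlt _ h2, hlt13, zab, zbc, zcd, zda, hab, hbc, hcd,
      hda, ?_, fun z hz' => ?_⟩
    · intro j
      have : l (q j) ≤ l (q i) := hi j
      have := h.2.1 (q (i + 3))
      omega
    · obtain ⟨h1, h2, h3, h4⟩ := hz z hz'
      exact hout z h4 h1 h2 h3

theorem cycleGraph_four_adj_iff (i j : Fin 4) : (cycleGraph 4).Adj i j ↔ j = i + 1 ∨ j = i + 3 := by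
  revert i j
  decide

/-- The sums satisfy `b + c < c + d < d + a`, so they give three distinct isolates. The fourth, `a +
b`, may coincide with `c + d`. -/
theorem three_le_of_isSumGraph_cycleGraph_four {k : ℕ}
    (h : ((cycleGraph 4).addIsolates k).IsSumGraph) : 3 ≤ k := by
  obtain ⟨l, h⟩ := h
  obtain ⟨a, b, c, d, -, had, hbd, hca, zab, zbc, zcd, zda, hab, hbc, hcd, hda, -, hz⟩ :=
    h.exists_sums (q := Sum.inl) Sum.inl_injective fun i w => by
      rcases w with w | w
      · simp [addIsolates, cycleGraph_four_adj_iff]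
      · simp [addIsolates]
  have key : ∀ z, z ∉ Set.range (Sum.inl : Fin 4 → Fin 4 ⊕ Fin k) → ∃ i, z = Sum.inr i := by
    rintro (z | z) hz
    · exact (hz ⟨z, rfl⟩).elim
    · exact ⟨z, rfl⟩
  obtain ⟨i, rfl⟩ := key _ (hz zbc (by simp))
  obtain ⟨i', rfl⟩ := key _ (hz zcd (by simp))
  obtain ⟨i'', rfl⟩ := key _ (hz zda (by simp))
  have h1 : i ≠ i' := by rintro rfl; omega
  have h2 : i ≠ i'' := by rintro rfl; omega
  have h3 : i' ≠ i'' := by rintro rfl; omega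
  have := Fin.val_ne_of_ne h1
  have := Fin.val_ne_of_ne h2
  have := Fin.val_ne_of_ne h3
  omega

/-- The three distinct sums `b + c < c + d < d + a` must be exactly the labels of `x`, `y` and the
isolate `e`. As `x + y = e`, the largest is `e`, so `d + a = (b + c) + (c + d)`, that is `a = c + (b
+ c)`. Thus `c` would be adjacent to the vertex of `P₂` labelled `b + c`. -/
theorem not_isSumGraph_cycleGraph_four_sum_pathGraph_two :
    ¬ ((cycleGraph 4 ⊕g pathGraph 2).addIsolates 1).IsSumGraph := by
  rintro ⟨l, h⟩
  obtain ⟨a, b, c, d, ⟨i, rfl⟩, had, hbd, hca, zab, zbc, zcd, zda, hab, hbc, hcd, hda, hlt, hz⟩ :=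
    h.exists_sums (q := fun i => Sum.inl (Sum.inl i)) (fun i j hij => by simpa using hij)
      fun i w => by
        rcases w with (w | w) | w
        · simp [addIsolates, cycleGraph_four_adj_iff]
        · simp [addIsolates]
        · simp [addIsolates]
  set x : (Fin 4 ⊕ Fin 2) ⊕ Fin 1 := Sum.inl (Sum.inr 0) with hx
  set y : (Fin 4 ⊕ Fin 2) ⊕ Fin 1 := Sum.inl (Sum.inr 1) with hy
  set e : (Fin 4 ⊕ Fin 2) ⊕ Fin 1 := Sum.inr 0 with he
  have cover : ∀ z, (∃ i, z = Sum.inl (Sum.inl i)) ∨ z = x ∨ z = y ∨ z = e := by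
    rintro ((z | z) | z)
    · exact Or.inl ⟨z, rfl⟩
    · fin_cases z <;> simp [hx, hy]
    · right; right; right
      rw [he, Subsingleton.elim z 0]
  have out : ∀ z, (z = zab ∨ z = zbc ∨ z = zcd ∨ z = zda) → l z = l x ∨ l z = l y ∨ l z = l e := by
    intro z hz'
    rcases cover z with ⟨i, hi⟩ | rfl | rfl | rfl
    · exact (hz z hz' ⟨i, hi.symm⟩).elim
    · exact Or.inl rfl
    · exact Or.inr (Or.inl rfl)
    · exact Or.inr (Or.inr rfl)
  have oab := out zab (by simp)
  have obc := out zbc (by simp)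
  have ocd := out zcd (by simp)
  have oda := out zda (by simp)
  have hxy : ((cycleGraph 4 ⊕g pathGraph 2).addIsolates 1).Adj x y := by
    simp [addIsolates, hx, hy, pathGraph_adj]
  obtain ⟨-, zxy, hzxy⟩ := (h.2.2 x y).1 hxy
  have px := h.2.1 x
  have py := h.2.1 y
  -- Two of the three sums are at least `c + d`, so one of `x`, `y` is. Hence `x + y` exceeds every
  -- label of the four-cycle.
  have oxy : l zxy = l e := by
    rcases cover zxy with ⟨i, rfl⟩ | rfl | rfl | rfl
    · have : l (Sum.inl (Sum.inl i)) < l zcd := hlt i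
      omega
    · omega
    · omega
    · rfl
  have hcx : ∀ z, l z ≠ l (Sum.inl (Sum.inl i)) + l x := by
    intro z hz
    have := h.adj (by simp [hx]) hz
    simp [addIsolates, hx] at this
  have hcy : ∀ z, l z ≠ l (Sum.inl (Sum.inl i)) + l y := by
    intro z hz
    have := h.adj (by simp [hy]) hz
    simp [addIsolates, hy] at this
  have hxa := hcx a
  have hya := hcy a
  have pb := h.2.1 b
  have pc := h.2.1 (Sum.inl (Sum.inl i))
  omega

/-- The coincidence `3 + 10 = 12 + 1` reduces the four edge sums to 4, 13, 22. With a further `P₂`,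
as in the labelling used for `C₄ + P₂`, two of them become its vertices. -/
theorem isSumGraph_cycleGraph_four : ((cycleGraph 4).addIsolates 3).IsSumGraph := by
  have : SumLabellingWith (cycleGraph 4) ![1, 3, 10, 12] {4, 13, 22} :=
    { inj := by decide
      pos := by decide
      pos_out := by decide
      disj := by decide
      adj_iff := by decide
      out := by decide
      out_out := by decide }
  exact this.isSumGraph

theorem isSumGraph_cycleGraph_four_sum_pathGraph_two :
    ((cycleGraph 4 ⊕g pathGraph 2).addIsolates 2).IsSumGraph := by
  have hadj : ∀ x y, (cycleGraph 4 ⊕g pathGraph 2).Adj x y ↔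
      x ≠ y ∧ ((∃ z, Sum.elim ![1, 3, 10, 12] ![4, 13] z =
        Sum.elim ![1, 3, 10, 12] ![4, 13] x + Sum.elim ![1, 3, 10, 12] ![4, 13] y) ∨
        Sum.elim ![1, 3, 10, 12] ![4, 13] x + Sum.elim ![1, 3, 10, 12] ![4, 13] y ∈
          ({17, 22} : Finset ℕ)) := by
    rintro (x | x) (y | y)
    · rw [SimpleGraph.sum_adj_inl]
      revert x y
      decide
    · simp only [SimpleGraph.sum_adj]
      revert x y
      decide
    · simp only [SimpleGraph.sum_adj]
      revert x y
      decide
    · rw [SimpleGraph.sum_adj_inr, pathGraph_adj]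
      revert x y
      decide
  have : SumLabellingWith (cycleGraph 4 ⊕g pathGraph 2) (Sum.elim ![1, 3, 10, 12] ![4, 13])
      {17, 22} :=
    { inj := by decide
      pos := by decide
      pos_out := by decide
      disj := by decide
      adj_iff := hadj
      out := by decide
      out_out := by decide }
  exact this.isSumGraph

/-! ### The minimum degree in terms of adjacency. -/

section minDegree

variable [Fintype V] [DecidableRel G.Adj]

theorem two_le_degree_iff_exists (x : V) :
    2 ≤ G.degree x ↔ ∃ y z, y ≠ z ∧ G.Adj x y ∧ G.Adj x z := by
  rw [← card_neighborFinset_eq_degree, Nat.succ_le_iff, Finset.one_lt_card_iff]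
  simp only [mem_neighborFinset]
  tauto

theorem minDegree_eq_two [Nonempty V] (hmax : G.maxDegree ≤ 2)
    (h : ∀ x, ∃ y z, y ≠ z ∧ G.Adj x y ∧ G.Adj x z) : G.minDegree = 2 := by
  refine le_antisymm ?_ ?_
  · obtain ⟨x⟩ := ‹Nonempty V›
    exact (G.minDegree_le_degree x).trans ((G.degree_le_maxDegree x).trans hmax)
  · exact G.le_minDegree_of_forall_le_degree _ fun x => (two_le_degree_iff_exists x).2 (h x)

theorem minDegree_eq_one (hiso : ∀ x, ∃ y, G.Adj x y)
    (h : ∃ x y, G.Adj x y ∧ ∀ z, G.Adj x z → z = y) : G.minDegree = 1 := by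
  obtain ⟨x, y, hxy, hu⟩ := h
  have : Nonempty V := ⟨x⟩
  refine le_antisymm ?_ ?_
  · refine (G.minDegree_le_degree x).trans ?_
    by_contra hlt
    obtain ⟨u, w, huw, hu', hw'⟩ := (two_le_degree_iff_exists (G := G) x).1 (lt_of_not_ge hlt)
    exact huw ((hu u hu').trans (hu w hw').symm)
  · refine G.le_minDegree_of_forall_le_degree _ fun x => ?_
    rw [Nat.succ_le_iff, degree_pos_iff_exists_adj]
    exact hiso x

end minDegree

end SimpleGraph

/-! ### Assembly of the bounds. -/

namespace SimpleGraph

variable {V : Type*} {G : SimpleGraph V}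

theorem sumNumber_of_iso_cycleGraph_four (e : G ≃g cycleGraph 4) : G.sumNumber = 3 :=
  sumNumber_eq (isSumGraph_addIsolates_of_iso e isSumGraph_cycleGraph_four) fun _ h =>
    three_le_of_isSumGraph_cycleGraph_four (isSumGraph_addIsolates_of_iso e.symm h)

theorem sumNumber_of_iso_cycleGraph_four_sum_pathGraph_two [Finite V] [Nonempty V]
    (hiso : ∀ x, ∃ y, G.Adj x y) (e : G ≃g cycleGraph 4 ⊕g pathGraph 2) : G.sumNumber = 2 := by
  refine sumNumber_eq
    (isSumGraph_addIsolates_of_iso e isSumGraph_cycleGraph_four_sum_pathGraph_two) fun k h => ?_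
  have h1 := one_le_of_isSumGraph hiso h
  have h2 : k ≠ 1 := by
    rintro rfl
    exact not_isSumGraph_cycleGraph_four_sum_pathGraph_two (isSumGraph_addIsolates_of_iso e.symm h)
  omega

/-- Every disjoint union of paths and cycles other than `C₄` and `C₄ + P₂` is a sum graph after
adding as many isolates as its minimum degree. -/
theorem isSumGraph_union {L : List Component} (h0 : L ≠ []) (h2 : L ≠ [.cycle 1])
    (h3 : ¬ L.Perm [.cycle 1, .path 0]) :
    ((∃ n, Component.path n ∈ L) → ((Component.union L).addIsolates 1).IsSumGraph) ∧
      ((∀ n, Component.path n ∉ L) → ((Component.union L).addIsolates 2).IsSumGraph) := by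
  -- `P₂` has no labelling with one isolate that contains a parallelogram, but it needs none here.
  by_cases h1 : L = [.path 0]
  · subst h1
    refine ⟨fun _ => ?_, fun h => (h 0 List.mem_cons_self).elim⟩
    exact (((twoOutLabelling_of_isEmpty (G := Component.union []) isEmptyElim).path
      le_rfl).labelling).isSumGraph
  · have h := Component.hasGoodLabelling L h0 h1 h2 h3
    exact ⟨fun hp => (h.1 hp).isSumGraph, fun hp => (h.2 hp).isSumGraph⟩

theorem exists_unique_adj_of_iso_union {V : Type*} {G : SimpleGraph V} {L : List Component}
    (e : G ≃g Component.union L) {n : ℕ} (hn : Component.path n ∈ L) :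
    ∃ x y, G.Adj x y ∧ ∀ z, G.Adj x z → z = y := by
  obtain ⟨x, y, hxy, hu⟩ := Component.exists_unique_adj_of_path_mem hn
  refine ⟨e.symm x, e.symm y, e.symm.map_adj_iff.2 hxy, fun z hz => ?_⟩
  obtain ⟨z, rfl⟩ := e.symm.surjective z
  rw [hu z (e.symm.map_adj_iff.1 hz)]

theorem exists_two_adj_of_iso_union {L : List Component}
    (e : G ≃g Component.union L) (hL : ∀ n, Component.path n ∉ L) (x : V) :
    ∃ y z, y ≠ z ∧ G.Adj x y ∧ G.Adj x z := by
  obtain ⟨y, z, hyz, hy, hz⟩ := Component.exists_two_adj hL (e x)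
  refine ⟨e.symm y, e.symm z, e.symm.injective.ne hyz, ?_, ?_⟩
  · rw [← e.map_adj_iff, e.apply_symm_apply]
    exact hy
  · rw [← e.map_adj_iff, e.apply_symm_apply]
    exact hz

theorem sumNumber_of_isEmpty [IsEmpty V] : G.sumNumber = 0 := by
  refine sumNumber_eq ⟨isEmptyElim, fun x => isEmptyElim x, fun x => isEmptyElim x,
    fun x => isEmptyElim x⟩ fun _ _ => Nat.zero_le _

theorem eq_or_eq_or_eq_of_maxDegree_le_two [Fintype V] [DecidableRel G.Adj]
    (h : G.maxDegree ≤ 2) (x a b c : V) (ha : G.Adj x a) (hb : G.Adj x b) (hc : G.Adj x c) :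
    a = b ∨ a = c ∨ b = c := by
  by_contra hne
  push Not at hne
  have h2 : 2 < (G.neighborFinset x).card :=
    Finset.two_lt_card_iff.2 ⟨a, b, c, by simpa using ha, by simpa using hb, by simpa using hc,
      hne.1, hne.2.1, hne.2.2⟩
  rw [card_neighborFinset_eq_degree] at h2
  have := G.degree_le_maxDegree x
  omega

end SimpleGraph

theorem theorem1 {V : Type u} [Fintype V] (G : SimpleGraph V) [DecidableRel G.Adj]
    (hmax : G.maxDegree ≤ 2) (hiso : ∀ v : V, ¬ G.IsIsolated v) :
    ((Nonempty (G ≃g SimpleGraph.cycleGraph 4) ∨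
        Nonempty (G ≃g (SimpleGraph.cycleGraph 4 ⊕g SimpleGraph.pathGraph 2))) →
      G.sumNumber = G.minDegree + 1) ∧
    (¬ (Nonempty (G ≃g SimpleGraph.cycleGraph 4) ∨
        Nonempty (G ≃g (SimpleGraph.cycleGraph 4 ⊕g SimpleGraph.pathGraph 2))) →
      G.sumNumber = G.minDegree) := by
  have hadj : ∀ x, ∃ y, G.Adj x y := fun x => G.exists_adj_iff_not_isIsolated.2 (hiso x)
  obtain ⟨L, ⟨e⟩⟩ := SimpleGraph.exists_iso_union
    (SimpleGraph.eq_or_eq_or_eq_of_maxDegree_le_two hmax) hadj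
  refine ⟨?_, fun hne => ?_⟩
  · rintro (⟨⟨f⟩⟩ | ⟨⟨f⟩⟩)
    · have : Nonempty V := ⟨f.symm 0⟩
      rw [SimpleGraph.sumNumber_of_iso_cycleGraph_four f, SimpleGraph.minDegree_eq_two hmax]
      exact SimpleGraph.exists_two_adj_of_iso_union (L := [.cycle 1])
        (f.trans (Component.unionSingletonIso (.cycle 1)).symm) (by simp)
    · have : Nonempty V := ⟨f.symm (Sum.inl 0)⟩
      rw [SimpleGraph.sumNumber_of_iso_cycleGraph_four_sum_pathGraph_two hadj f,
        SimpleGraph.minDegree_eq_one hadj]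
      exact SimpleGraph.exists_unique_adj_of_iso_union (L := [.cycle 1, .path 0]) (n := 0)
        (f.trans (Component.unionPairIso (.cycle 1) (.path 0)).symm) (by simp)
  · rcases isEmpty_or_nonempty V with hV | hV
    -- The empty graph satisfies the hypotheses; its `minDegree` is 0 by convention, as is its sum
    -- number.
    · rw [SimpleGraph.sumNumber_of_isEmpty, SimpleGraph.minDegree_of_subsingleton]
    have h0 : L ≠ [] := by
      rintro rfl
      obtain ⟨x⟩ := hV
      exact isEmptyElim (e x)
    have h2 : L ≠ [.cycle 1] := by
      rintro rfl
      exact hne (Or.inl ⟨e.trans (Component.unionSingletonIso (.cycle 1))⟩)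
    have h3 : ¬ L.Perm [.cycle 1, .path 0] := by
      intro hp
      obtain ⟨f⟩ := Component.nonempty_union_iso_of_perm hp
      exact hne (Or.inr ⟨(e.trans f).trans (Component.unionPairIso (.cycle 1) (.path 0))⟩)
    obtain ⟨hone, htwo⟩ := SimpleGraph.isSumGraph_union h0 h2 h3
    by_cases hP : ∃ n, Component.path n ∈ L
    · rw [SimpleGraph.minDegree_eq_one hadj (SimpleGraph.exists_unique_adj_of_iso_union e hP.choose_spec)]
      exact SimpleGraph.sumNumber_eq (SimpleGraph.isSumGraph_addIsolates_of_iso e (hone hP))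
        fun _ h => SimpleGraph.one_le_of_isSumGraph hadj h
    · rw [not_exists] at hP
      have htwo_adj := SimpleGraph.exists_two_adj_of_iso_union e hP
      rw [SimpleGraph.minDegree_eq_two hmax htwo_adj]
      exact SimpleGraph.sumNumber_eq (SimpleGraph.isSumGraph_addIsolates_of_iso e (htwo hP))
        fun _ h => SimpleGraph.two_le_of_isSumGraph htwo_adj h
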